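/- Let $H$ be a separable complex Hilbert space with an orthonormal basis $(e_i)$, let $\mathcal T(H)$ be the trace class operators on $H$, so that $B(H)=\mathcal T(H)^*$, and call $s\in\mathcal T(H)$ a state if $s\ge 0$ and $\operatorname{tr}(s)=1$. Let $X$ be a set with a $\sigma$-algebra $\mathcal O(X)$, and let $\nu:\mathcal O(X)\to B(H)$ be a positive operator-valued measure (POVM), i.e. $\nu(E)\ge 0$ for all $E$ and $\nu(\bigcup_k E_k)=\sum_k\nu(E_k)$ in the weak$^*$ (ultraweak) topology for pairwise disjoint $E_1,E_2,\dots\in\mathcal O(X)$. Let $\rho$ be a full-rank (injective) state and $\nu_\rho(E)=\operatorname{tr}(\rho\,\nu(E))$. Suppose that the Radon–Nikodým derivative $D=\frac{d\nu}{d\nu_\rho}$ exists. This means that there is a function $D:X\to B(H)$ such that $x\mapsto\operatorname{tr}(sD(x))$ is measurable for every state $s$, each $x\mapsto\langle D(x)e_j,e_i\rangle$ is $\nu_\rho$-integrable, and $\langle\nu(E)e_j,e_i\rangle=\int_E\langle D(x)e_j,e_i\rangle\,d\nu_\rho(x)$ for all $i,j$ and all $E\in\mathcal O(X)$. For a $\nu$-integrable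 function $f:X\to B(H)$ let $\mathcal E_\nu(f)=\int_X f\,d\nu\in B(H)$ be the operator with $$\operatorname{tr}\big(s\,\mathcal E_\nu(f)\big)=\int_X\operatorname{tr}\big(s\,D(x)^{1/2}f(x)D(x)^{1/2}\big)\,d\nu_\rho(x)\quad\text{for all states } s.$$ Here $f$ is assumed to be such that $x\mapsto\operatorname{tr}(sf(x))$ is measurable for all states $s$, and it is called $\nu$-integrable if, for each $g$ among $(\operatorname{Re}f)_\pm,(\operatorname{Im}f)_\pm$ and each state $s$, the function $x\mapsto\operatorname{tr}(s\,D(x)^{1/2}g(x)D(x)^{1/2})$ is $\nu_\rho$-integrable. Assume that 1. $\nu$ is nonatomic: there is no $E\in\mathcal O(X)$ with $\nu(E)\ne0$ such that every $F\in\mathcal O(X)$ with $F\subseteq E$ satisfies $\nu(F)=0$ or $\nu(F)=\nu(E)$; 2. integration against $\nu$ is classically non-injective: for every $E\in\mathcal O(X)$ with $\nu(E)\neq0$ the map $L^\infty(E,\nu)\to B(H)$, $f\mapsto\mathcal E_\nu(fI)$, is not injective, where $L^\infty(E,\nu)$ consists of the $\nu$-essentially bounded measurable $f:X\to\mathbb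 C$ vanishing outside $E$, modulo equality $\nu$-almost everywhere. Then the range $\mathcal R_\nu=\{\nu(E):E\in\mathcal O(X)\}$ is a convex and weak$^*$-compact subset of $B(H)$. Moreover, for every measurable $h:X\to[0,1]$ the integral $\mathcal E_\nu(hI)$ exists and is uniquely determined, and $$\mathcal R_\nu=\{\mathcal E_\nu(hI)\;:\;h:X\to[0,1]\text{ measurable}\}.$$ -/

import Mathlib

open MeasureTheory Filter Topology
open scoped InnerProductSpace ComplexStarModule ComplexOrder

namespace OperatorMeasure

variable {ι H X : Type*} [NormedAddCommGroup H] [InnerProductSpace ℂ H] [CompleteSpace H]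

/-! ### Trace, trace class operators, states and the weak-star topology of `B(H)`

An orthonormal basis `e` of `H` is fixed throughout; the trace, the trace class and the
topology below do not depend on it. -/

/-- The trace `∑ᵢ ⟨A eᵢ, eᵢ⟩` (the inner product of Mathlib is linear in the second slot). It is
only applied to products of a trace class operator with bounded operators, where the series
converges absolutely. -/
noncomputable def trace (e : HilbertBasis ι ℂ H) (A : H →L[ℂ] H) : ℂ :=
  ∑' i, ⟪e i, A (e i)⟫_ℂ

/-- The trace class `T(H)`: the linear span of the positive operators of finite trace. -/
def traceClass (e : HilbertBasis ι ℂ H) : Submodule ℂ (H →L[ℂ] H) :=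
  Submodule.span ℂ {T | 0 ≤ T ∧ Summable fun i => ⟪e i, T (e i)⟫_ℂ}

/-- The weak-star (ultraweak) topology on `B(H)`, the dual of `T(H)`: the coarsest topology for
which `A ↦ tr(T A)` is continuous for every trace class operator `T`. -/
@[reducible] noncomputable def ultraweak (e : HilbertBasis ι ℂ H) : TopologicalSpace (H →L[ℂ] H) :=
  ⨅ T : traceClass e,
    TopologicalSpace.induced (fun A => trace e ((T : H →L[ℂ] H) * A)) inferInstance

/-- States (density operators): positive operators of trace one. -/
structure State (e : HilbertBasis ι ℂ H) where
  op : H →L[ℂ] H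
  nonneg : 0 ≤ op
  hasSum_one : HasSum (fun i => ⟪e i, op (e i)⟫_ℂ) 1

/-- A state has full rank if it is injective (equivalently, being self-adjoint, it has dense
range). -/
def State.FullRank {e : HilbertBasis ι ℂ H} (ρ : State e) : Prop :=
  Function.Injective ρ.op

/-! ### Positive operator valued measures -/

/-- A positive operator-valued measure on a measurable space `X`: a map from the measurable sets
to positive operators (values on non-measurable sets are never used) which is countably additive
in the ultraweak topology. -/
structure POVM (X : Type*) [MeasurableSpace X] (e : HilbertBasis ι ℂ H) where
  toFun : Set X → (H →L[ℂ] H)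
  nonneg : ∀ E, MeasurableSet E → 0 ≤ toFun E
  tendsto_sum : ∀ E : ℕ → Set X, (∀ k, MeasurableSet (E k)) →
    (∀ j k, j ≠ k → E j ∩ E k = ∅) →
    Tendsto (fun n => ∑ k ∈ Finset.range n, toFun (E k)) atTop
      (@nhds _ (ultraweak e) (toFun (⋃ k, E k)))

instance [MeasurableSpace X] (e : HilbertBasis ι ℂ H) :
    CoeFun (POVM X e) (fun _ => Set X → (H →L[ℂ] H)) := ⟨POVM.toFun⟩

/-! ### Facts needed to build the scalar measure `E ↦ tr(ρ ν(E))` -/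

theorem hasSum_norm_sq (e : HilbertBasis ι ℂ H) (x : H) :
    HasSum (fun i => ‖⟪x, e i⟫_ℂ‖ ^ 2) (‖x‖ ^ 2) := by
  have h := Complex.hasSum_re (e.hasSum_inner_mul_inner x x)
  have h1 : (fun i => (⟪x, e i⟫_ℂ * ⟪e i, x⟫_ℂ).re) = fun i => ‖⟪x, e i⟫_ℂ‖ ^ 2 := by
    funext i
    rw [← inner_conj_symm (e i) x, Complex.mul_conj, Complex.ofReal_re, Complex.normSq_eq_norm_sq]
  have h2 : (⟪x, x⟫_ℂ).re = ‖x‖ ^ 2 := inner_self_eq_norm_sq (𝕜 := ℂ) x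
  rw [h1, h2] at h
  exact h

/-- If `B` is self-adjoint and Hilbert–Schmidt then `tr(B B A)` converges and equals
`tr(B A B)`. -/
theorem exists_hasSum_swap (e : HilbertBasis ι ℂ H) {B : H →L[ℂ] H} (hB : IsSelfAdjoint B)
    (hs : Summable fun i => ‖B (e i)‖ ^ 2) (A : H →L[ℂ] H) :
    ∃ t : ℂ, HasSum (fun i => ⟪e i, (B * B * A) (e i)⟫_ℂ) t ∧
      HasSum (fun j => ⟪B (e j), A (B (e j))⟫_ℂ) t := by
  have hsym : ∀ x y, ⟪B x, y⟫_ℂ = ⟪x, B y⟫_ℂ := fun x y => by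
    conv_lhs => rw [← hB.adjoint_eq]
    exact ContinuousLinearMap.adjoint_inner_left _ _ _
  set A' := ContinuousLinearMap.adjoint A with hA'
  let F : ι × ι → ℂ := fun p => ⟪B (e p.1), e p.2⟫_ℂ * ⟪A' (B (e p.2)), e p.1⟫_ℂ
  have hprod : ∀ C : H →L[ℂ] H, (Summable fun i => ‖C (e i)‖ ^ 2) →
      Summable fun p : ι × ι => ‖⟪C (e p.1), e p.2⟫_ℂ‖ ^ 2 := fun C hC => by
    refine (summable_prod_of_nonneg fun p => by positivity).2
      ⟨fun i => (hasSum_norm_sq e (C (e i))).summable, ?_⟩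
    simpa only [(hasSum_norm_sq e _).tsum_eq] using hC
  have h1 := hprod B hs
  have h2' : Summable fun i => ‖(A' * B) (e i)‖ ^ 2 := by
    refine Summable.of_nonneg_of_le (fun i => by positivity) (fun i => ?_) (hs.mul_left (‖A'‖ ^ 2))
    rw [← mul_pow]
    exact pow_le_pow_left₀ (norm_nonneg _) (A'.le_opNorm _) 2
  have h2 := (Equiv.prodComm ι ι).summable_iff.2 (hprod (A' * B) h2')
  have hF : Summable F := by
    refine Summable.of_norm (Summable.of_nonneg_of_le (fun _ => norm_nonneg _) (fun p => ?_)
      (h1.add h2))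
    simp only [F, norm_mul, Function.comp, Equiv.prodComm_apply, Prod.fst_swap, Prod.snd_swap,
      mul_apply_eq_comp]
    nlinarith [sq_nonneg (‖⟪B (e p.1), e p.2⟫_ℂ‖ - ‖⟪A' (B (e p.2)), e p.1⟫_ℂ‖),
      sq_nonneg (‖⟪B (e p.1), e p.2⟫_ℂ‖), sq_nonneg (‖⟪A' (B (e p.2)), e p.1⟫_ℂ‖)]
  have hF2 := (Equiv.prodComm ι ι).hasSum_iff.2 hF.hasSum
  refine ⟨∑' p, F p, hF.hasSum.prod_fiberwise fun i => ?_, hF2.prod_fiberwise fun j => ?_⟩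
  · have h := e.hasSum_inner_mul_inner (B (e i)) (B (A (e i)))
    have h3 : ∀ j, ⟪e j, B (A (e i))⟫_ℂ = ⟪A' (B (e j)), e i⟫_ℂ := fun j => by
      rw [← hsym, hA', ContinuousLinearMap.adjoint_inner_left]
    simp only [h3] at h
    rw [hsym] at h
    exact h
  · have h := e.hasSum_inner_mul_inner (A' (B (e j))) (B (e j))
    have h3 : ∀ i, ⟪e i, B (e j)⟫_ℂ = ⟪B (e i), e j⟫_ℂ := fun i => (hsym _ _).symm
    simp only [h3] at h
    have h4 : ⟪A' (B (e j)), B (e j)⟫_ℂ = ⟪B (e j), A (B (e j))⟫_ℂ := by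
      rw [hA', ContinuousLinearMap.adjoint_inner_left]
    rw [h4] at h
    simpa only [F, Function.comp, Equiv.prodComm_apply, Prod.fst_swap, Prod.snd_swap, mul_comm]
      using h

/-- For `T ≥ 0` of finite trace, `tr(T A) = tr(T^{1/2} A T^{1/2})`. -/
theorem exists_hasSum_pos (e : HilbertBasis ι ℂ H) {T : H →L[ℂ] H} (hT : 0 ≤ T)
    (hs : Summable fun i => ⟪e i, T (e i)⟫_ℂ) (A : H →L[ℂ] H) :
    ∃ t : ℂ, HasSum (fun i => ⟪e i, (T * A) (e i)⟫_ℂ) t ∧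
      HasSum (fun j => ⟪CFC.sqrt T (e j), A (CFC.sqrt T (e j))⟫_ℂ) t := by
  have hB : IsSelfAdjoint (CFC.sqrt T) := (CFC.sqrt_nonneg T).isSelfAdjoint
  have hBB := CFC.sqrt_mul_sqrt_self T hT
  have h := exists_hasSum_swap e hB ?_ A
  · rwa [hBB] at h
  · have h2 := (Complex.hasSum_re hs.hasSum).summable
    refine h2.congr fun i => ?_
    have h3 : ⟪e i, T (e i)⟫_ℂ = ⟪CFC.sqrt T (e i), CFC.sqrt T (e i)⟫_ℂ := by
      conv_lhs => rw [← hBB, mul_apply_eq_comp]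
      conv_rhs => rw [← hB.adjoint_eq, ContinuousLinearMap.adjoint_inner_left, hB.adjoint_eq]
    rw [h3]
    exact inner_self_eq_norm_sq (𝕜 := ℂ) _

theorem summable_trace (e : HilbertBasis ι ℂ H) {T : H →L[ℂ] H} (hT : T ∈ traceClass e)
    (A : H →L[ℂ] H) : Summable fun i => ⟪e i, (T * A) (e i)⟫_ℂ := by
  induction hT using Submodule.span_induction with
  | mem T h => exact (exists_hasSum_pos e h.1 h.2 A).choose_spec.1.summable
  | zero => simp
  | add S T _ _ hS hT =>
    refine (hS.add hT).congr fun i => ?_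
    rw [add_mul, add_apply, inner_add_right]
  | smul c T _ hT =>
    refine (hT.mul_left c).congr fun i => ?_
    rw [smul_mul_assoc, smul_apply, inner_smul_right]

theorem trace_nonneg (e : HilbertBasis ι ℂ H) {T A : H →L[ℂ] H} (hT : 0 ≤ T)
    (hs : Summable fun i => ⟪e i, T (e i)⟫_ℂ) (hA : 0 ≤ A) : 0 ≤ trace e (T * A) := by
  obtain ⟨t, h1, h2⟩ := exists_hasSum_pos e hT hs A
  rw [trace, h1.tsum_eq, ← h2.tsum_eq]
  exact tsum_nonneg fun j =>
    ((ContinuousLinearMap.nonneg_iff_isPositive A).1 hA).inner_nonneg_right _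

theorem trace_mul_sum (e : HilbertBasis ι ℂ H) {T : H →L[ℂ] H} (hT : T ∈ traceClass e)
    (s : Finset ℕ) (A : ℕ → (H →L[ℂ] H)) :
    trace e (T * ∑ k ∈ s, A k) = ∑ k ∈ s, trace e (T * A k) := by
  simp only [trace]
  rw [← Summable.tsum_finsetSum fun k _ => summable_trace e hT (A k)]
  refine tsum_congr fun i => ?_
  rw [Finset.mul_sum, sum_apply, inner_sum]

theorem State.mem_traceClass {e : HilbertBasis ι ℂ H} (ρ : State e) : ρ.op ∈ traceClass e :=
  Submodule.subset_span ⟨ρ.nonneg, ρ.hasSum_one.summable⟩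

theorem continuous_trace_mul (e : HilbertBasis ι ℂ H) {T : H →L[ℂ] H} (hT : T ∈ traceClass e) :
    @Continuous _ _ (ultraweak e) _ fun A => trace e (T * A) :=
  continuous_iInf_dom (i := (⟨T, hT⟩ : traceClass e)) continuous_induced_dom

namespace POVM

variable [MeasurableSpace X] {e : HilbertBasis ι ℂ H} (ν : POVM X e)

theorem trace_nonneg (ρ : State e) {E : Set X} (hE : MeasurableSet E) :
    0 ≤ trace e (ρ.op * ν E) :=
  OperatorMeasure.trace_nonneg e ρ.nonneg ρ.hasSum_one.summable (ν.nonneg E hE)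

theorem hasSum_trace_re (ρ : State e) {E : ℕ → Set X} (hE : ∀ k, MeasurableSet (E k))
    (hd : ∀ j k, j ≠ k → E j ∩ E k = ∅) :
    HasSum (fun k => (trace e (ρ.op * ν (E k))).re) (trace e (ρ.op * ν (⋃ k, E k))).re := by
  rw [hasSum_iff_tendsto_nat_of_nonneg fun k =>
    (Complex.nonneg_iff.1 (ν.trace_nonneg ρ (hE k))).1]
  have h := ((@Continuous.tendsto _ _ (ultraweak e) _ _
    (continuous_trace_mul e ρ.mem_traceClass) _).comp (ν.tendsto_sum E hE hd))
  have h2 := (Complex.continuous_re.tendsto _).comp h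
  simpa only [Function.comp_def, trace_mul_sum e ρ.mem_traceClass, Complex.re_sum] using h2

/-- The finite positive measure `ν_ρ(E) = tr(ρ ν(E))`. -/
noncomputable def scalar (ρ : State e) : Measure X :=
  Measure.ofMeasurable (fun E _ => ENNReal.ofReal (trace e (ρ.op * ν E)).re)
    (by
      have h := ν.hasSum_trace_re ρ (E := fun _ => ∅) (fun _ => MeasurableSet.empty) (by simp)
      have h0 := (summable_const_iff _).1 h.summable
      simp [h0])
    (fun E hE hd => by
      have h := ν.hasSum_trace_re ρ hE (fun j k hjk => (hd hjk).inter_eq)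
      rw [← h.tsum_eq]
      exact ENNReal.ofReal_tsum_of_nonneg
        (fun k => (Complex.nonneg_iff.1 (ν.trace_nonneg ρ (hE k))).1) h.summable)

theorem scalar_apply (ρ : State e) {E : Set X} (hE : MeasurableSet E) :
    (((ν.scalar ρ).real E : ℝ) : ℂ) = trace e (ρ.op * ν E) := by
  have h := Complex.nonneg_iff.1 (ν.trace_nonneg ρ hE)
  rw [Measure.real, scalar, Measure.ofMeasurable_apply E hE, ENNReal.toReal_ofReal h.1]
  exact Complex.ext rfl h.2

/-- `ν` is nonatomic: no measurable `E` with `ν(E) ≠ 0` is such that every measurable `F ⊆ E` has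
`ν(F) = 0` or `ν(F) = ν(E)`. -/
def Nonatomic : Prop :=
  ¬ ∃ E, MeasurableSet E ∧ ν E ≠ 0 ∧
    ∀ F, MeasurableSet F → F ⊆ E → ν F = 0 ∨ ν F = ν E

end POVM

/-! ### Quantum random variables, the Radon–Nikodým derivative and the integral -/

section Integral

variable [MeasurableSpace X] {e : HilbertBasis ι ℂ H}

/-- A quantum random variable: `x ↦ tr(s f(x))` is measurable for every state `s`. -/
def IsQuantumRandomVariable (e : HilbertBasis ι ℂ H) (f : X → (H →L[ℂ] H)) : Prop :=
  ∀ s : State e, Measurable fun x => trace e (s.op * f x)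

/-- `D` is (a version of) the Radon–Nikodým derivative `dν/dν_ρ`: it is a quantum random variable,
so in particular takes values in the bounded operators, and its matrix entries are the classical
Radon–Nikodým derivatives of the matrix entries `ν_{ij}(E) = ⟨ν(E) e_j, e_i⟩` with respect to
`ν_ρ`. The derivative exists if there is such a `D`. -/
structure IsRNDeriv (ν : POVM X e) (ρ : State e) (D : X → (H →L[ℂ] H)) : Prop where
  isQuantumRandomVariable : IsQuantumRandomVariable e D
  integrable : ∀ i j, Integrable (fun x => ⟪e i, D x (e j)⟫_ℂ) (ν.scalar ρ)
  setIntegral_eq : ∀ i j E, MeasurableSet E →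
    ⟪e i, ν E (e j)⟫_ℂ = ∫ x in E, ⟪e i, D x (e j)⟫_ℂ ∂(ν.scalar ρ)

/-- The function `f_s(x) = tr(s D(x)^{1/2} f(x) D(x)^{1/2})`. -/
noncomputable def sandwich (D : X → (H →L[ℂ] H)) (s : State e) (f : X → (H →L[ℂ] H)) (x : X) : ℂ :=
  trace e (s.op * (CFC.sqrt (D x) * f x * CFC.sqrt (D x)))

/-- Integrability of a positive quantum random variable `f`: every `f_s` is `ν_ρ`-integrable. -/
def PosIntegrable (ν : POVM X e) (ρ : State e) (D f : X → (H →L[ℂ] H)) : Prop :=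
  ∀ s : State e, Integrable (sandwich D s f) (ν.scalar ρ)

/-- `f` is `ν`-integrable if `(Re f)₊`, `(Re f)₋`, `(Im f)₊` and `(Im f)₋` are. -/
def QIntegrable (ν : POVM X e) (ρ : State e) (D f : X → (H →L[ℂ] H)) : Prop :=
  PosIntegrable ν ρ D (fun x => (ℜ (f x) : H →L[ℂ] H)⁺) ∧
  PosIntegrable ν ρ D (fun x => (ℜ (f x) : H →L[ℂ] H)⁻) ∧
  PosIntegrable ν ρ D (fun x => (ℑ (f x) : H →L[ℂ] H)⁺) ∧
  PosIntegrable ν ρ D (fun x => (ℑ (f x) : H →L[ℂ] H)⁻)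

/-- `HasQIntegral ν ρ D f A` says that `f` is a `ν`-integrable quantum random variable with integral
`ℰ_ν(f) = ∫ f dν = A`, that is, `tr(s A) = ∫ f_s dν_ρ` for every state `s`. Here `D = dν/dν_ρ`. -/
structure HasQIntegral (ν : POVM X e) (ρ : State e) (D f : X → (H →L[ℂ] H)) (A : H →L[ℂ] H) :
    Prop where
  isQuantumRandomVariable : IsQuantumRandomVariable e f
  integrable : QIntegrable ν ρ D f
  trace_eq : ∀ s : State e, trace e (s.op * A) = ∫ x, sandwich D s f x ∂(ν.scalar ρ)

/-- `f` represents an element of the scalar space `L^∞(E, ν)`: it is measurable, it is extended by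
zero outside `E`, and it is essentially bounded with respect to `ν`. -/
structure IsLInfty (ν : POVM X e) (E : Set X) (f : X → ℂ) : Prop where
  measurable : Measurable f
  eq_zero : ∀ x, x ∉ E → f x = 0
  essBounded : ∃ M : ℝ, ν {x | M < ‖f x‖} = 0

/-- Integration against `ν` is classically non-injective: for every measurable `E` with `ν(E) ≠ 0`,
the map `f ∈ L^∞(E, ν) ↦ ℰ_ν(f I)` is not injective, i.e. it takes the same value at two functions
which are not `ν`-almost everywhere equal. -/
def ClassicallyNonInjective (ν : POVM X e) (ρ : State e) (D : X → (H →L[ℂ] H)) : Prop :=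
  ∀ E, MeasurableSet E → ν E ≠ 0 →
    ∃ f g : X → ℂ, IsLInfty ν E f ∧ IsLInfty ν E g ∧ ν {x | f x ≠ g x} ≠ 0 ∧
      ∃ A : H →L[ℂ] H, HasQIntegral ν ρ D (fun x => f x • 1) A ∧
        HasQIntegral ν ρ D (fun x => g x • 1) A

end Integral

end OperatorMeasure

/-!
The measure `ν` and the scalar measure `μ = ν_ρ` have the same null sets, and `D ≥ 0` almost
everywhere, so `ℰ_ν(hI)` is the weak-star integral of `h D`. It depends weak-star continuously on
`h`, and the measurable `h : X → [0, 1]` form the weak-star compact convex order interval `[0, 1]`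
of `L^∞(μ)`; hence the operators `ℰ_ν(hI)` form a compact convex set, which contains
`ν(E) = ℰ_ν(1_E I)`. Conversely, given `h`, the functions `g : X → [0, 1]` with
`ℰ_ν(gI) = ℰ_ν(hI)` form a compact convex set, which has an extreme point `g` by Krein–Milman. If
`g` were not an indicator function, it would satisfy `ε ≤ g ≤ 1 - ε` on a non-null set `E`, and
non-injectivity on `E` would give a nonzero real `u ∈ L^∞(E)` with `ℰ_ν(uI) = 0`. Then `g ± t u` for
small `t > 0` contradict extremality, so `ℰ_ν(hI) = ν(F)` for some `F`. This is Lindenstrauss' proof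
of Lyapunov's theorem.
-/

namespace OperatorMeasure

section UnitInterval

open scoped ENNReal

variable {X : Type*} [MeasurableSpace X] {μ : Measure X}

/-- The pairing of `L^∞` with `L¹`, as a map from `L^∞` to the dual of `L¹`. The target carries the
weak-star topology, for which the unit interval of `L^∞` is compact. -/
noncomputable def dualPairing (μ : Measure X) : Lp ℝ ∞ μ →ₗ[ℝ] WeakDual ℝ (Lp ℝ 1 μ) :=
  StrongDual.toWeakDual.toLinearMap ∘ₗ
    ((ContinuousLinearMap.mul ℝ ℝ).lpPairing μ ∞ 1).toLinearMap

theorem dualPairing_apply (g : Lp ℝ ∞ μ) (f : Lp ℝ 1 μ) :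
    dualPairing μ g f = ∫ x, g x * f x ∂μ :=
  ContinuousLinearMap.lpPairing_eq_integral _ g f

theorem dualPairing_toL1 (g : Lp ℝ ∞ μ) {f : X → ℝ} (hf : Integrable f μ) :
    dualPairing μ g (hf.toL1 f) = ∫ x, g x * f x ∂μ := by
  rw [dualPairing_apply]
  refine integral_congr_ae ?_
  filter_upwards [hf.coeFn_toL1] with x hx
  rw [hx]

theorem dualPairing_indicatorConstLp (g : Lp ℝ ∞ μ) {E : Set X} (hE : MeasurableSet E)
    (hμE : μ E ≠ ∞) : dualPairing μ g (indicatorConstLp 1 hE hμE 1) = ∫ x in E, g x ∂μ := by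
  rw [dualPairing_apply, ← integral_indicator hE]
  refine integral_congr_ae ?_
  filter_upwards [indicatorConstLp_coeFn (p := 1) (hs := hE) (hμs := hμE) (c := (1 : ℝ))] with x hx
  by_cases hxE : x ∈ E <;> simp [hx, hxE]

/-- The functionals on `L¹` lying between `0` and integration: these are the `[0, 1]`-valued
functions of `L^∞`, seen in the dual of `L¹` with its weak-star topology. -/
def unitIntervalDual (μ : Measure X) : Set (WeakDual ℝ (Lp ℝ 1 μ)) :=
  {φ | ∀ f, 0 ≤ f → φ f ∈ Set.Icc 0 (∫ x, f x ∂μ)}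

theorem isClosed_unitIntervalDual : IsClosed (unitIntervalDual μ) := by
  simp only [unitIntervalDual, Set.ofPred_forall]
  exact isClosed_iInter fun f => isClosed_iInter fun _ =>
    isClosed_Icc.preimage (WeakDual.eval_continuous f)

theorem norm_le_one_of_mem_unitIntervalDual {φ : WeakDual ℝ (Lp ℝ 1 μ)}
    (hφ : φ ∈ unitIntervalDual μ) : ‖WeakDual.toStrongDual φ‖ ≤ 1 := by
  refine ContinuousLinearMap.opNorm_le_bound _ zero_le_one fun f => ?_
  have habs : φ |f| ≤ ‖f‖ := by
    refine (hφ _ (abs_nonneg f)).2.trans_eq ?_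
    rw [L1.norm_eq_integral_norm]
    exact integral_congr_ae (Lp.coeFn_abs f)
  have hle : ∀ g, g ≤ |f| → φ g ≤ φ |f| := fun g hg => by
    simpa only [map_sub, sub_nonneg] using (hφ _ (sub_nonneg.2 hg)).1
  rw [one_mul]
  change |φ f| ≤ _
  exact (abs_le'.2 ⟨hle f (le_abs_self f), by simpa using hle (-f) (neg_le_abs f)⟩).trans habs

theorem isCompact_unitIntervalDual : IsCompact (unitIntervalDual μ) := by
  refine (WeakDual.isCompact_closedBall (𝕜 := ℝ) (0 : StrongDual ℝ (Lp ℝ 1 μ)) 1).of_isClosed_subset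
    isClosed_unitIntervalDual fun φ hφ => ?_
  rw [Set.mem_preimage, mem_closedBall_zero_iff]
  exact norm_le_one_of_mem_unitIntervalDual hφ

theorem dualPairing_mem_unitIntervalDual {g : Lp ℝ ∞ μ}
    (hg : ∀ᵐ x ∂μ, g x ∈ Set.Icc (0 : ℝ) 1) :
    dualPairing μ g ∈ unitIntervalDual μ := fun f hf => by
  rw [dualPairing_apply]
  have hf0 := Lp.coeFn_nonneg f |>.2 hf
  have hle : (fun x => g x * f x) ≤ᵐ[μ] f := by
    filter_upwards [hg, hf0] with x hgx hfx using mul_le_of_le_one_left hfx hgx.2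
  have h0 : 0 ≤ᵐ[μ] fun x => g x * f x := by
    filter_upwards [hg, hf0] with x hgx hfx using mul_nonneg hgx.1 hfx
  exact ⟨integral_nonneg_of_ae h0, integral_mono_of_nonneg h0 (L1.integrable_coeFn f) hle⟩

/-- Riesz representation in `L²`, which embeds in `L¹`. -/
theorem exists_apply_indicatorConstLp_eq_setIntegral [IsFiniteMeasure μ]
    (ψ : StrongDual ℝ (Lp ℝ 1 μ)) :
    ∃ G : X → ℝ, Integrable G μ ∧ ∀ (E : Set X) (hE : MeasurableSet E),
      ψ (indicatorConstLp 1 hE (measure_ne_top μ E) 1) = ∫ x in E, G x ∂μ := by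
  have : ENNReal.HolderTriple 2 2 1 := ⟨by simpa using ENNReal.inv_two_add_inv_two⟩
  let one : Lp ℝ 2 μ := (memLp_const (1 : ℝ)).toLp (fun _ => 1)
  let J : Lp ℝ 2 μ →L[ℝ] Lp ℝ 1 μ := (ContinuousLinearMap.mul ℝ ℝ).holderL μ 2 2 1 one
  have hJ : ∀ f, J f =ᵐ[μ] f := fun f => by
    filter_upwards [(ContinuousLinearMap.mul ℝ ℝ).coeFn_holder (r := 1) one f,
      (memLp_const (1 : ℝ)).coeFn_toLp (μ := μ) (p := 2)] with x hx h1
    exact hx.trans (by rw [h1]; simp)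
  let G : Lp ℝ 2 μ := (InnerProductSpace.toDual ℝ (Lp ℝ 2 μ)).symm (ψ ∘L J)
  refine ⟨G, (Lp.memLp G).integrable one_le_two, fun E hE => ?_⟩
  have hμE := measure_ne_top μ E
  have hJE : J (indicatorConstLp 2 hE hμE 1) = indicatorConstLp 1 hE hμE 1 := by
    refine Lp.ext ((hJ _).trans (indicatorConstLp_coeFn.trans indicatorConstLp_coeFn.symm))
  calc ψ (indicatorConstLp 1 hE hμE 1)
      = ⟪G, indicatorConstLp 2 hE hμE 1⟫_ℝ := by
        rw [← hJE]
        exact (InnerProductSpace.toDual_symm_apply (𝕜 := ℝ) (y := ψ ∘L J)).symm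
    _ = ∫ x in E, G x ∂μ := by rw [real_inner_comm, L2.inner_indicatorConstLp_one]

theorem eq_of_apply_indicatorConstLp_eq [IsFiniteMeasure μ] {φ ψ : StrongDual ℝ (Lp ℝ 1 μ)}
    (h : ∀ (E : Set X) (hE : MeasurableSet E),
      φ (indicatorConstLp 1 hE (measure_ne_top μ E) 1)
        = ψ (indicatorConstLp 1 hE (measure_ne_top μ E) 1)) : φ = ψ := by
  refine ContinuousLinearMap.ext fun f => Lp.induction ENNReal.one_ne_top
    (motive := fun f => φ f = ψ f) (fun c E hE hμE => ?_)
    (fun f g hf hg _ hφψf hφψg => by rw [map_add, map_add, hφψf, hφψg])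
    (isClosed_eq φ.continuous ψ.continuous) f
  have hsmul : indicatorConstLp 1 hE hμE.ne c = c • indicatorConstLp 1 hE hμE.ne (1 : ℝ) := by
    simp only [indicatorConstLp, ← MemLp.toLp_const_smul]
    congr 1
    funext x
    by_cases hx : x ∈ E <;> simp [hx]
  rw [Lp.simpleFunc.coe_indicatorConst, hsmul, map_smul, map_smul, h]

theorem exists_dualPairing_eq_of_mem_unitIntervalDual [IsFiniteMeasure μ]
    {φ : WeakDual ℝ (Lp ℝ 1 μ)} (hφ : φ ∈ unitIntervalDual μ) :
    ∃ g : Lp ℝ ∞ μ, (∀ᵐ x ∂μ, g x ∈ Set.Icc (0 : ℝ) 1) ∧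
      dualPairing μ g = φ := by
  obtain ⟨G, hG, hφG⟩ := exists_apply_indicatorConstLp_eq_setIntegral (WeakDual.toStrongDual φ)
  have hmem : ∀ (E : Set X), MeasurableSet E → ∫ x in E, G x ∂μ ∈ Set.Icc 0 (∫ x in E, 1 ∂μ) :=
    fun E hE => by
      have h := hφ (indicatorConstLp 1 hE (measure_ne_top μ E) 1) ((Lp.coeFn_nonneg _).1 (by
        filter_upwards [indicatorConstLp_coeFn (p := 1) (hs := hE) (hμs := measure_ne_top μ E)
          (c := (1 : ℝ))] with x hx
        rw [hx]
        exact Set.indicator_nonneg (fun _ _ => zero_le_one) x))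
      rw [integral_indicatorConstLp] at h
      simpa [← hφG E hE] using h
  have h01 : ∀ᵐ x ∂μ, G x ∈ Set.Icc (0 : ℝ) 1 :=
    (ae_nonneg_of_forall_setIntegral_nonneg hG fun E hE _ => (hmem E hE).1).and
      (ae_le_of_forall_setIntegral_le hG (integrable_const 1) fun E hE _ => (hmem E hE).2)
  have hGtop : MemLp G ∞ μ := memLp_top_of_bound hG.aestronglyMeasurable 1 (h01.mono fun x hx => by
    rw [Real.norm_of_nonneg hx.1]; exact hx.2)
  refine ⟨hGtop.toLp G, ?_, eq_of_apply_indicatorConstLp_eq fun E hE => ?_⟩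
  · filter_upwards [hGtop.coeFn_toLp, h01] with x hx hx01
    rwa [hx]
  · exact (dualPairing_indicatorConstLp _ hE (measure_ne_top μ E)).trans <|
      (setIntegral_congr_ae hE (hGtop.coeFn_toLp.mono fun x hx _ => hx)).trans (hφG E hE).symm

theorem dualPairing_injective [IsFiniteMeasure μ] : Function.Injective (dualPairing μ) :=
  fun g h hgh => Lp.ext <| Integrable.ae_eq_of_forall_setIntegral_eq g h
    ((Lp.memLp g).integrable le_top) ((Lp.memLp h).integrable le_top) fun E hE hμE => by
      rw [← dualPairing_indicatorConstLp g hE hμE.ne, hgh, dualPairing_indicatorConstLp]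

/-- The functions of `L^∞` with values in `[0, 1]` whose moments against the functions `d k` are
prescribed. -/
def momentSet (μ : Measure X) {κ : Type*} (d : κ → X → ℝ) (c : κ → ℝ) : Set (Lp ℝ ∞ μ) :=
  {g | (∀ᵐ x ∂μ, g x ∈ Set.Icc (0 : ℝ) 1) ∧ ∀ k, ∫ x, g x * d k x ∂μ = c k}

/-- Every non-null set carries a nonzero function of `L^∞` whose moments against the functions `d k`
all vanish: the linear map `u ↦ (∫ u d_k)_k` is injective on none of the spaces `L^∞(E)`. -/
def NowhereInjectiveMoments (μ : Measure X) {κ : Type*} (d : κ → X → ℝ) : Prop :=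
  ∀ E, MeasurableSet E → μ E ≠ 0 → ∃ u : Lp ℝ ∞ μ, u ≠ 0 ∧
    (∀ᵐ x ∂μ, x ∉ E → u x = 0) ∧ ∀ k, ∫ x, u x * d k x ∂μ = 0

variable {κ : Type*} {d : κ → X → ℝ} {c : κ → ℝ}

theorem isCompact_image_dualPairing_momentSet [IsFiniteMeasure μ]
    (hd : ∀ k, Integrable (d k) μ) : IsCompact (dualPairing μ '' momentSet μ d c) := by
  have h : dualPairing μ '' momentSet μ d c =
      unitIntervalDual μ ∩ ⋂ k, {φ | φ ((hd k).toL1 _) = c k} := by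
    ext φ
    simp only [Set.mem_inter_iff, Set.mem_iInter]
    constructor
    · rintro ⟨g, hg, rfl⟩
      exact ⟨dualPairing_mem_unitIntervalDual hg.1, fun k =>
        (dualPairing_toL1 g (hd k)).trans (hg.2 k)⟩
    · rintro ⟨hφ, hφd⟩
      obtain ⟨g, hg, rfl⟩ := exists_dualPairing_eq_of_mem_unitIntervalDual hφ
      exact ⟨g, ⟨hg, fun k => (dualPairing_toL1 g (hd k)).symm.trans (hφd k)⟩, rfl⟩
  rw [h]
  exact isCompact_unitIntervalDual.inter_right <| isClosed_iInter fun k =>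
    isClosed_eq (WeakDual.eval_continuous _) continuous_const

theorem extremePoints_momentSet_nonempty [IsFiniteMeasure μ] (hd : ∀ k, Integrable (d k) μ)
    (hne : (momentSet μ d c).Nonempty) : (Set.extremePoints ℝ (momentSet μ d c)).Nonempty := by
  have : LocallyConvexSpace ℝ (WeakDual ℝ (Lp ℝ 1 μ)) :=
    inferInstanceAs (LocallyConvexSpace ℝ (WeakBilin (topDualPairing ℝ (Lp ℝ 1 μ))))
  obtain ⟨_, ⟨g, hg, rfl⟩, hext⟩ :=
    (isCompact_image_dualPairing_momentSet hd).extremePoints_nonempty (hne.image _)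
  refine ⟨g, hg, fun g₁ hg₁ g₂ hg₂ hgg => dualPairing_injective ?_⟩
  refine hext (Set.mem_image_of_mem _ hg₁) (Set.mem_image_of_mem _ hg₂) ?_
  obtain ⟨a, b, ha, hb, hab, rfl⟩ := hgg
  exact ⟨a, b, ha, hb, hab, by rw [map_add, map_smul, map_smul]⟩

theorem ae_norm_le_norm_Lp_top (u : Lp ℝ ∞ μ) : ∀ᵐ x ∂μ, ‖u x‖ ≤ ‖u‖ := by
  filter_upwards [ae_le_eLpNormEssSup (f := u) (μ := μ)] with x hx
  rw [← eLpNorm_exponent_top, ← Lp.enorm_def] at hx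
  exact enorm_le_iff_norm_le.1 hx

theorem add_smul_mem_momentSet (hd : ∀ k, Integrable (d k) μ) {g u : Lp ℝ ∞ μ}
    (hg : g ∈ momentSet μ d c) (hud : ∀ k, ∫ x, u x * d k x ∂μ = 0) {r : ℝ}
    (h01 : ∀ᵐ x ∂μ, g x + r * u x ∈ Set.Icc (0 : ℝ) 1) : g + r • u ∈ momentSet μ d c := by
  have hcoe : ⇑(g + r • u) =ᵐ[μ] fun x => g x + r * u x := by
    filter_upwards [Lp.coeFn_add g (r • u), Lp.coeFn_smul r u] with x hadd hsmul
    rw [hadd, Pi.add_apply, hsmul, Pi.smul_apply, smul_eq_mul]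
  refine ⟨?_, fun k => ?_⟩
  · filter_upwards [hcoe, h01] with x hx hx01
    rwa [hx]
  · have hint : ∀ f : Lp ℝ ∞ μ, Integrable (fun x => f x * d k x) μ := fun f =>
      (hd k).mul_of_top_right (Lp.memLp f)
    calc ∫ x, (g + r • u) x * d k x ∂μ
        = ∫ x, (g x * d k x + r * (u x * d k x)) ∂μ := integral_congr_ae <| by
          filter_upwards [hcoe] with x hx
          rw [hx, add_mul, mul_assoc]
      _ = c k := by
          rw [integral_add (hint g) ((hint u).const_mul r), integral_const_mul, hud, mul_zero,
            add_zero, hg.2]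

/-- There is a nonzero perturbation supported where `ε ≤ g ≤ 1 - ε`; scaled to sup norm `ε`, it can
be both added to and subtracted from `g`. -/
theorem measure_le_and_le_eq_zero_of_mem_extremePoints
    (hker : NowhereInjectiveMoments μ d) (hd : ∀ k, Integrable (d k) μ)
    {g : Lp ℝ ∞ μ} (hg : g ∈ Set.extremePoints ℝ (momentSet μ d c)) {ε : ℝ} (hε : 0 < ε) :
    μ {x | ε ≤ g x ∧ g x ≤ 1 - ε} = 0 := by
  have hgm := (Lp.stronglyMeasurable g).measurable
  by_contra hμ
  obtain ⟨u, hu, huE, hud⟩ := hker _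
    ((measurableSet_le measurable_const hgm).inter (measurableSet_le hgm measurable_const)) hμ
  have hmem : ∀ r : ℝ, |r| ≤ ε / ‖u‖ → g + r • u ∈ momentSet μ d c := fun r hr => by
    refine add_smul_mem_momentSet hd hg.1 hud ?_
    filter_upwards [hg.1.1, huE, ae_norm_le_norm_Lp_top u] with x h01 hxE hxu
    by_cases hxmid : ε ≤ g x ∧ g x ≤ 1 - ε
    · have hru : |r * u x| ≤ ε := by
        rw [abs_mul]
        exact (mul_le_mul hr hxu (norm_nonneg _) (by positivity)).trans_eq
          (div_mul_cancel₀ _ (norm_ne_zero_iff.2 hu))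
      have := abs_le.1 hru
      exact ⟨by linarith, by linarith⟩
    · simpa [hxE hxmid] using h01
  have hpos : 0 < ε / ‖u‖ := div_pos hε (norm_pos_iff.2 hu)
  have hext := hg.2 (hmem (ε / ‖u‖) (abs_of_pos hpos).le)
    (hmem (-(ε / ‖u‖)) (by rw [abs_neg, abs_of_pos hpos]))
    ⟨1 / 2, 1 / 2, by norm_num, by norm_num, by norm_num, by module⟩
  exact smul_ne_zero hpos.ne' hu (add_eq_left.1 hext)

theorem ae_eq_zero_or_one_of_mem_extremePoints
    (hker : NowhereInjectiveMoments μ d) (hd : ∀ k, Integrable (d k) μ)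
    {g : Lp ℝ ∞ μ} (hg : g ∈ Set.extremePoints ℝ (momentSet μ d c)) :
    ∀ᵐ x ∂μ, g x = 0 ∨ g x = 1 := by
  have hmid : ∀ᵐ x ∂μ, ∀ n : ℕ, ¬ (1 / ((n : ℝ) + 1) ≤ g x ∧ g x ≤ 1 - 1 / ((n : ℝ) + 1)) :=
    ae_all_iff.2 fun n => measure_eq_zero_iff_ae_notMem.1
      (measure_le_and_le_eq_zero_of_mem_extremePoints hker hd hg Nat.one_div_pos_of_nat)
  filter_upwards [hmid, hg.1.1] with x hx h01
  by_contra! hne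
  have hpos : 0 < min (g x) (1 - g x) :=
    lt_min (h01.1.lt_of_ne hne.1.symm) (sub_pos.2 (h01.2.lt_of_ne hne.2))
  obtain ⟨n, hn⟩ := exists_nat_one_div_lt hpos
  exact hx n ⟨(hn.trans_le (min_le_left _ _)).le, by linarith [min_le_right (g x) (1 - g x)]⟩

theorem exists_setIntegral_eq [IsFiniteMeasure μ]
    (hker : NowhereInjectiveMoments μ d) (hd : ∀ k, Integrable (d k) μ)
    (hc : (momentSet μ d c).Nonempty) :
    ∃ E, MeasurableSet E ∧ ∀ k, ∫ x in E, d k x ∂μ = c k := by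
  obtain ⟨g, hg⟩ := extremePoints_momentSet_nonempty hd hc
  have hE : MeasurableSet {x | g x = 1} :=
    (Lp.stronglyMeasurable g).measurable (measurableSet_singleton 1)
  refine ⟨_, hE, fun k => ?_⟩
  rw [← hg.1.2 k, ← integral_indicator hE]
  refine integral_congr_ae ?_
  filter_upwards [ae_eq_zero_or_one_of_mem_extremePoints hker hd hg] with x hx
  rcases hx with hx | hx <;> simp [hx]

theorem exists_Lp_ne_zero_of_memLp (hd : ∀ k, Integrable (d k) μ) {E : Set X} {f : X → ℂ}
    (hf : MemLp f ∞ μ) (hfE : ∀ x, x ∉ E → f x = 0) (hf0 : ¬ f =ᵐ[μ] 0)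
    (hfd : ∀ k, ∫ x, f x * (d k x : ℂ) ∂μ = 0) :
    ∃ u : Lp ℝ ∞ μ, u ≠ 0 ∧ (∀ᵐ x ∂μ, x ∉ E → u x = 0) ∧ ∀ k, ∫ x, u x * d k x ∂μ = 0 := by
  suffices hreal : ∃ v : X → ℝ, MemLp v ∞ μ ∧ (∀ x, x ∉ E → v x = 0) ∧ ¬ v =ᵐ[μ] 0 ∧
      ∀ k, ∫ x, v x * d k x ∂μ = 0 by
    obtain ⟨v, hv, hvE, hv0, hvd⟩ := hreal
    refine ⟨hv.toLp v, fun h => hv0 (hv.coeFn_toLp.symm.trans (Lp.eq_zero_iff_ae_eq_zero.1 h)), ?_,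
      fun k => (integral_congr_ae ?_).trans (hvd k)⟩
    · filter_upwards [hv.coeFn_toLp] with x hx hxE
      rw [hx, hvE x hxE]
    · filter_upwards [hv.coeFn_toLp] with x hx
      rw [hx]
  have hint : ∀ k, Integrable (fun x => f x * (d k x : ℂ)) μ := fun k =>
    (hd k).ofReal.mul_of_top_right hf
  by_cases hre : (fun x => (f x).re) =ᵐ[μ] 0
  · refine ⟨fun x => (f x).im, hf.im, fun x hx => by simp [hfE x hx],
      fun him => hf0 ?_, fun k => ?_⟩
    · filter_upwards [hre, him] with x hxre hxim using Complex.ext hxre hxim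
    · simpa [hfd] using integral_im (hint k)
  · refine ⟨fun x => (f x).re, hf.re, fun x hx => by simp [hfE x hx], hre,
      fun k => ?_⟩
    simpa [hfd] using integral_re (hint k)

theorem exists_measurable_ae_eq_of_ae_mem_Icc {g : X → ℝ} (hg : AEMeasurable g μ)
    (hg01 : ∀ᵐ x ∂μ, g x ∈ Set.Icc (0 : ℝ) 1) :
    ∃ h : X → ℝ, Measurable h ∧ (∀ x, h x ∈ Set.Icc (0 : ℝ) 1) ∧ g =ᵐ[μ] h := by
  obtain ⟨h, hh, hrange, hgh⟩ := hg.exists_ae_eq_range_subset hg01 ⟨0, by simp⟩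
  exact ⟨h, hh, Set.range_subset_iff.1 hrange, hgh⟩

theorem dualPairing_toL1_re_add_im (g : Lp ℝ ∞ μ) {f : X → ℂ} (hf : Integrable f μ) :
    (dualPairing μ g (hf.re.toL1 _) : ℂ) + dualPairing μ g (hf.im.toL1 _) * Complex.I
      = ∫ x, (g x : ℂ) * f x ∂μ := by
  have hgf : Integrable (fun x => (g x : ℂ) * f x) μ :=
    hf.mul_of_top_right (Lp.memLp g).ofReal
  rw [dualPairing_toL1, dualPairing_toL1, ← integral_re_add_im hgf]
  simp

theorem memLp_top_of_mem_Icc {h : X → ℝ} (hm : Measurable h)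
    (h01 : ∀ x, h x ∈ Set.Icc (0 : ℝ) 1) : MemLp h ∞ μ :=
  memLp_top_of_bound hm.aestronglyMeasurable 1 <| ae_of_all _ fun x => by
    rw [Real.norm_of_nonneg (h01 x).1]
    exact (h01 x).2

theorem isCompact_moments [IsFiniteMeasure μ] {d : κ → X → ℂ} (hd : ∀ k, Integrable (d k) μ) :
    IsCompact {c : κ → ℂ | ∃ h : X → ℝ, Measurable h ∧ (∀ x, h x ∈ Set.Icc (0 : ℝ) 1) ∧
      ∀ k, ∫ x, (h x : ℂ) * d k x ∂μ = c k} := by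
  let I : WeakDual ℝ (Lp ℝ 1 μ) → κ → ℂ := fun φ k =>
    (φ ((hd k).re.toL1 _) : ℂ) + φ ((hd k).im.toL1 _) * Complex.I
  have hI : Continuous I := continuous_pi fun k =>
    (Complex.continuous_ofReal.comp (WeakDual.eval_continuous _)).add
      ((Complex.continuous_ofReal.comp (WeakDual.eval_continuous _)).mul continuous_const)
  convert isCompact_unitIntervalDual.image hI using 1
  ext c
  constructor
  · rintro ⟨h, hm, h01, hc⟩
    have hmem : MemLp h ∞ μ := memLp_top_of_mem_Icc hm h01
    refine ⟨dualPairing μ (hmem.toLp h), dualPairing_mem_unitIntervalDual ?_, funext fun k => ?_⟩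
    · filter_upwards [hmem.coeFn_toLp] with x hx
      exact hx ▸ h01 x
    · refine (dualPairing_toL1_re_add_im _ (hd k)).trans ((integral_congr_ae ?_).trans (hc k))
      filter_upwards [hmem.coeFn_toLp] with x hx
      rw [hx]
  · rintro ⟨φ, hφ, rfl⟩
    obtain ⟨g, hg, rfl⟩ := exists_dualPairing_eq_of_mem_unitIntervalDual hφ
    obtain ⟨h, hm, h01, hgh⟩ :=
      exists_measurable_ae_eq_of_ae_mem_Icc (Lp.stronglyMeasurable g).measurable.aemeasurable hg
    refine ⟨h, hm, h01, fun k => ((integral_congr_ae ?_).trans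
      (dualPairing_toL1_re_add_im g (hd k)).symm)⟩
    filter_upwards [hgh] with x hx
    rw [hx]

end UnitInterval

section Operators

variable {ι H : Type*} [NormedAddCommGroup H] [InnerProductSpace ℂ H]

theorem inner_apply_self_nonneg {A : H →L[ℂ] H} (hA : 0 ≤ A) (v : H) : 0 ≤ ⟪v, A v⟫_ℂ :=
  ((ContinuousLinearMap.nonneg_iff_isPositive A).1 hA).inner_nonneg_right v

theorem nonneg_of_forall_inner_apply_self_nonneg {A : H →L[ℂ] H} (hA : ∀ v, 0 ≤ ⟪v, A v⟫_ℂ) :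
    0 ≤ A := by
  rw [ContinuousLinearMap.nonneg_iff_isPositive, ContinuousLinearMap.isPositive_iff_complex]
  refine fun v => ?_
  have h : ⟪A v, v⟫_ℂ = ⟪v, A v⟫_ℂ := by
    rw [← inner_conj_symm, Complex.conj_eq_iff_im]
    exact (Complex.nonneg_iff.1 (hA v)).2.symm
  have h₂ := Complex.nonneg_iff.1 (hA v)
  rw [h]
  exact ⟨Complex.ext rfl h₂.2, h₂.1⟩

theorem dense_span_range (e : HilbertBasis ι ℂ H) :
    Dense (Submodule.span ℂ (Set.range e) : Set H) :=
  Submodule.dense_iff_topologicalClosure_eq_top.2 e.dense_span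

theorem eq_of_inner_apply_basis_eq (e : HilbertBasis ι ℂ H) {A B : H →L[ℂ] H}
    (h : ∀ i j, ⟪e i, A (e j)⟫_ℂ = ⟪e i, B (e j)⟫_ℂ) : A = B := by
  refine ContinuousLinearMap.ext_on (dense_span_range e) ?_
  rintro _ ⟨j, rfl⟩
  refine e.repr.injective (lp.ext (funext fun i => ?_))
  rw [e.repr_apply_apply, e.repr_apply_apply, h]

theorem countable_of_hilbertBasis [TopologicalSpace.SeparableSpace H] (e : HilbertBasis ι ℂ H) :
    Countable ι := by
  have hdisj : (Set.univ : Set ι).PairwiseDisjoint fun i => Metric.ball (e i) (1 / 2) := by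
    intro i _ j _ hij
    refine Metric.ball_disjoint_ball ?_
    have hdist : ‖e i - e j‖ ^ 2 = 2 := by
      rw [norm_sub_sq (𝕜 := ℂ), e.orthonormal.1, e.orthonormal.1, e.orthonormal.2 hij]
      norm_num
    rw [dist_eq_norm]
    nlinarith [norm_nonneg (e i - e j)]
  exact Set.countable_univ_iff.1 <| hdisj.countable_of_isOpen (fun _ _ => Metric.isOpen_ball)
    fun i _ => Metric.nonempty_ball.2 one_half_pos

variable [CompleteSpace H]

theorem inner_sqrt_apply_sqrt_apply {A : H →L[ℂ] H} (hA : 0 ≤ A) (v w : H) :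
    ⟪CFC.sqrt A v, CFC.sqrt A w⟫_ℂ = ⟪v, A w⟫_ℂ := by
  have hsa : IsSelfAdjoint (CFC.sqrt A) := (CFC.sqrt_nonneg A).isSelfAdjoint
  rw [← ContinuousLinearMap.adjoint_inner_right, hsa.adjoint_eq, ← mul_apply_eq_comp,
    CFC.sqrt_mul_sqrt_self A hA]

theorem enorm_sqrt_apply_mul_self {A : H →L[ℂ] H} (hA : 0 ≤ A) (v : H) :
    ‖CFC.sqrt A v‖ₑ * ‖CFC.sqrt A v‖ₑ = ‖⟪v, A v⟫_ℂ‖ₑ := by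
  rw [← inner_sqrt_apply_sqrt_apply hA, ← ofReal_norm, ← ofReal_norm,
    ← ENNReal.ofReal_mul (norm_nonneg _), ← inner_self_eq_norm_mul_norm (𝕜 := ℂ),
    inner_self_re_eq_norm]

theorem enorm_inner_apply_le {A : H →L[ℂ] H} (hA : 0 ≤ A) (v w : H) :
    ‖⟪v, A w⟫_ℂ‖ₑ ≤ ‖⟪v, A v⟫_ℂ‖ₑ ^ (1 / 2 : ℝ) * ‖⟪w, A w⟫_ℂ‖ₑ ^ (1 / 2 : ℝ) := by
  have hsqrt : ∀ u, ‖⟪u, A u⟫_ℂ‖ₑ ^ (1 / 2 : ℝ) = ‖CFC.sqrt A u‖ₑ := fun u => by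
    rw [← enorm_sqrt_apply_mul_self hA, ← sq, ← ENNReal.rpow_natCast_mul]
    norm_num
  rw [hsqrt, hsqrt, ← inner_sqrt_apply_sqrt_apply hA]
  exact ENNReal.coe_le_coe.2 (nnnorm_inner_le_nnnorm (𝕜 := ℂ) (CFC.sqrt A v) (CFC.sqrt A w))

end Operators

section Trace

variable {ι H : Type*} [NormedAddCommGroup H] [InnerProductSpace ℂ H]
  {e : HilbertBasis ι ℂ H}

theorem trace_smul_mul (c : ℂ) (T A : H →L[ℂ] H) :
    trace e ((c • T) * A) = c * trace e (T * A) := by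
  simp only [trace, smul_mul_assoc, smul_apply, inner_smul_right, tsum_mul_left]

theorem trace_mul_smul (c : ℂ) (T A : H →L[ℂ] H) :
    trace e (T * (c • A)) = c * trace e (T * A) := by
  rw [mul_smul_comm, ← smul_mul_assoc, trace_smul_mul]

variable [CompleteSpace H]

theorem trace_add_mul {S T : H →L[ℂ] H} (hS : S ∈ traceClass e)
    (hT : T ∈ traceClass e) (A : H →L[ℂ] H) :
    trace e ((S + T) * A) = trace e (S * A) + trace e (T * A) := by
  simp only [trace, add_mul, add_apply, inner_add_right]
  exact (summable_trace e hS A).tsum_add (summable_trace e hT A)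

theorem trace_mul_add {T : H →L[ℂ] H} (hT : T ∈ traceClass e) (A B : H →L[ℂ] H) :
    trace e (T * (A + B)) = trace e (T * A) + trace e (T * B) := by
  simp only [trace, mul_add, add_apply, inner_add_right]
  exact (summable_trace e hT A).tsum_add (summable_trace e hT B)

theorem hasSum_trace_mul_of_nonneg {T : H →L[ℂ] H} (hT : 0 ≤ T)
    (hs : Summable fun i => ⟪e i, T (e i)⟫_ℂ) (A : H →L[ℂ] H) :
    HasSum (fun j => ⟪CFC.sqrt T (e j), A (CFC.sqrt T (e j))⟫_ℂ) (trace e (T * A)) := by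
  obtain ⟨t, htrace, hsqrt⟩ := exists_hasSum_pos e hT hs A
  rwa [trace, htrace.tsum_eq]

/-- The rank one projection onto a unit vector, as a state. -/
noncomputable def pureState (e : HilbertBasis ι ℂ H) (v : H) (hv : ‖v‖ = 1) : State e where
  op := InnerProductSpace.rankOne ℂ v v
  nonneg := (ContinuousLinearMap.nonneg_iff_isPositive _).2
    (InnerProductSpace.isPositive_rankOne_self v)
  hasSum_one := by
    simpa [inner_smul_right, inner_self_eq_norm_sq_to_K, hv] using e.hasSum_inner_mul_inner v v

theorem trace_pureState_mul {v : H} (hv : ‖v‖ = 1) (A : H →L[ℂ] H) :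
    trace e ((pureState e v hv).op * A) = ⟪v, A v⟫_ℂ := by
  have h := e.hasSum_inner_mul_inner (ContinuousLinearMap.adjoint A v) v
  simp only [ContinuousLinearMap.adjoint_inner_left] at h
  rw [trace, ← h.tsum_eq]
  exact tsum_congr fun i => inner_smul_right _ _ _

theorem eq_of_trace_state_mul_eq {A B : H →L[ℂ] H}
    (h : ∀ s : State e, trace e (s.op * A) = trace e (s.op * B)) : A = B := by
  have hdiag : ∀ v, ⟪A v, v⟫_ℂ = ⟪B v, v⟫_ℂ := fun v => by
    rcases eq_or_ne v 0 with rfl | hv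
    · simp only [inner_zero_right]
    obtain ⟨c, u, hu, rfl⟩ : ∃ (c : ℂ) (u : H), ‖u‖ = 1 ∧ v = c • u :=
      ⟨‖v‖, ((‖v‖⁻¹ : ℝ) : ℂ) • v, by simp [norm_smul, hv], by simp [smul_smul, hv]⟩
    have hinner := h (pureState e u hu)
    rw [trace_pureState_mul, trace_pureState_mul, ← inner_conj_symm, ← inner_conj_symm u] at hinner
    rw [map_smul, map_smul, inner_smul_left, inner_smul_left, inner_smul_right, inner_smul_right,
      (starRingEnd ℂ).injective hinner]
  exact ContinuousLinearMap.coe_injective ((ext_inner_map _ _).1 hdiag)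

end Trace

section WeakIntegral

open scoped NNReal

variable {ι H X : Type*} [NormedAddCommGroup H] [InnerProductSpace ℂ H] [MeasurableSpace X]
  {e : HilbertBasis ι ℂ H} {μ : Measure X} {F G : X → H →L[ℂ] H} {A B : H →L[ℂ] H} {C : ℝ≥0}

theorem isInducing_ultraweak (e : HilbertBasis ι ℂ H) :
    @Topology.IsInducing _ _ (ultraweak e) _
      fun (A : H →L[ℂ] H) (T : traceClass e) => trace e ((T : H →L[ℂ] H) * A) := by
  refine @Topology.IsInducing.mk _ _ (ultraweak e) _ _ ?_
  rw [Pi.topologicalSpace, induced_iInf]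
  simp only [induced_compose]
  rfl

/-- `A` is the weak-star (Gelfand) integral of `F`: integration commutes with the pairing with
every trace class operator. -/
structure HasGelfandIntegral (e : HilbertBasis ι ℂ H) (μ : Measure X) (F : X → H →L[ℂ] H)
    (A : H →L[ℂ] H) : Prop where
  integrable : ∀ T ∈ traceClass e, Integrable (fun x => trace e (T * F x)) μ
  trace_eq : ∀ T ∈ traceClass e, trace e (T * A) = ∫ x, trace e (T * F x) ∂μ

/-- The weak-star integrals against `F` of the measurable functions with values in `[0, 1]`. -/
def unitIntervalIntegrals (e : HilbertBasis ι ℂ H) (μ : Measure X) (F : X → H →L[ℂ] H) :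
    Set (H →L[ℂ] H) :=
  {A | ∃ h : X → ℝ, Measurable h ∧ (∀ x, h x ∈ Set.Icc (0 : ℝ) 1) ∧
    HasGelfandIntegral e μ (fun x => (h x : ℂ) • F x) A}

theorem HasGelfandIntegral.const_smul (hA : HasGelfandIntegral e μ F A) (c : ℂ) :
    HasGelfandIntegral e μ (fun x => c • F x) (c • A) where
  integrable T hT := by
    simp only [trace_mul_smul]
    exact (hA.integrable T hT).const_mul c
  trace_eq T hT := by
    simp only [trace_mul_smul]
    rw [integral_const_mul, hA.trace_eq T hT]

/-- Weak integrability of an operator-valued function, with a bound `C` for the norm of the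
sesquilinear map which sends a pair of vectors to the corresponding matrix entry in `L¹`. -/
structure WeaklyIntegrableWith (C : ℝ≥0) (μ : Measure X) (F : X → H →L[ℂ] H) : Prop where
  aestronglyMeasurable : ∀ v w, AEStronglyMeasurable (fun x => ⟪v, F x w⟫_ℂ) μ
  lintegral_enorm_le : ∀ v w, ∫⁻ x, ‖⟪v, F x w⟫_ℂ‖ₑ ∂μ ≤ C * ‖v‖ₑ * ‖w‖ₑ

namespace WeaklyIntegrableWith

theorem integrable (hF : WeaklyIntegrableWith C μ F) (v w : H) :
    Integrable (fun x => ⟪v, F x w⟫_ℂ) μ :=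
  ⟨hF.aestronglyMeasurable v w, (hF.lintegral_enorm_le v w).trans_lt <|
    ENNReal.mul_lt_top (ENNReal.mul_lt_top ENNReal.coe_lt_top enorm_lt_top) enorm_lt_top⟩

theorem smul (hF : WeaklyIntegrableWith C μ F) {h : X → ℂ} (hm : AEStronglyMeasurable h μ)
    {M : ℝ≥0} (hM : ∀ᵐ x ∂μ, ‖h x‖ ≤ M) :
    WeaklyIntegrableWith (M * C) μ fun x => h x • F x where
  aestronglyMeasurable v w := by
    simp only [smul_apply, inner_smul_right]
    exact hm.mul (hF.aestronglyMeasurable v w)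
  lintegral_enorm_le v w := by
    calc ∫⁻ x, ‖⟪v, (h x • F x) w⟫_ℂ‖ₑ ∂μ
        ≤ ∫⁻ x, M * ‖⟪v, F x w⟫_ℂ‖ₑ ∂μ := lintegral_mono_ae <| by
          filter_upwards [hM] with x hx
          rw [smul_apply, inner_smul_right, enorm_mul]
          exact mul_le_mul_left (ENNReal.coe_le_coe.2 hx) _
      _ = M * ∫⁻ x, ‖⟪v, F x w⟫_ℂ‖ₑ ∂μ := lintegral_const_mul' _ _ ENNReal.coe_ne_top
      _ ≤ M * (C * ‖v‖ₑ * ‖w‖ₑ) := by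
          gcongr
          exact hF.lintegral_enorm_le v w
      _ = ↑(M * C) * ‖v‖ₑ * ‖w‖ₑ := by rw [ENNReal.coe_mul, mul_assoc, mul_assoc, mul_assoc]

theorem norm_integral_inner_le (hF : WeaklyIntegrableWith C μ F) (v w : H) :
    ‖∫ x, ⟪v, F x w⟫_ℂ ∂μ‖ ≤ C * ‖v‖ * ‖w‖ := by
  have h := (enorm_integral_le_lintegral_enorm _).trans (hF.lintegral_enorm_le v w)
  simpa using ENNReal.toReal_mono (by finiteness) h

variable [CompleteSpace H]

theorem exists_inner_eq_integral (hF : WeaklyIntegrableWith C μ F) :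
    ∃ A : H →L[ℂ] H, ∀ v w, ⟪v, A w⟫_ℂ = ∫ x, ⟪v, F x w⟫_ℂ ∂μ := by
  let B : H →ₗ⋆[ℂ] H →ₗ[ℂ] ℂ := LinearMap.mk₂'ₛₗ (starRingEnd ℂ) (RingHom.id ℂ)
    (fun v w => ∫ x, ⟪v, F x w⟫_ℂ ∂μ)
    (fun v v' w => by
      simp only [inner_add_left]
      exact integral_add (hF.integrable v w) (hF.integrable v' w))
    (fun c v w => by
      simp only [inner_smul_left]
      exact integral_const_mul _ _)
    (fun v w w' => by
      simp only [map_add, inner_add_right]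
      exact integral_add (hF.integrable v w) (hF.integrable v w'))
    (fun c v w => by
      simp only [map_smul, inner_smul_right]
      exact integral_const_mul _ _)
  refine ⟨ContinuousLinearMap.adjoint (InnerProductSpace.continuousLinearMapOfBilin
    (B.mkContinuous₂ C hF.norm_integral_inner_le)), fun v w => ?_⟩
  rw [ContinuousLinearMap.adjoint_inner_right, InnerProductSpace.continuousLinearMapOfBilin_apply]
  rfl

theorem tsum_lintegral_enorm_inner_sqrt_ne_top (hF : WeaklyIntegrableWith C μ F) {T : H →L[ℂ] H}
    (hT : 0 ≤ T) (hs : Summable fun i => ⟪e i, T (e i)⟫_ℂ) :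
    ∑' j, ∫⁻ x, ‖⟪CFC.sqrt T (e j), F x (CFC.sqrt T (e j))⟫_ℂ‖ₑ ∂μ ≠ ⊤ := by
  refine ne_top_of_le_ne_top (ENNReal.mul_ne_top (ENNReal.coe_ne_top (r := C))
    (tsum_enorm_ne_top_iff_summable_norm.2 hs.norm)) ?_
  rw [← ENNReal.tsum_mul_left]
  refine ENNReal.tsum_le_tsum fun j => (hF.lintegral_enorm_le _ _).trans_eq ?_
  rw [mul_assoc, enorm_sqrt_apply_mul_self hT]

theorem integrable_trace_mul_of_nonneg [Countable ι] (hF : WeaklyIntegrableWith C μ F)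
    {T : H →L[ℂ] H} (hT : 0 ≤ T) (hs : Summable fun i => ⟪e i, T (e i)⟫_ℂ) :
    Integrable (fun x => trace e (T * F x)) μ := by
  have htr : ∀ x, HasSum (fun j => ⟪CFC.sqrt T (e j), F x (CFC.sqrt T (e j))⟫_ℂ)
      (trace e (T * F x)) := fun x => hasSum_trace_mul_of_nonneg hT hs (F x)
  constructor
  · exact aestronglyMeasurable_of_tendsto_ae (atTop : Filter (Finset ι))
      (fun s => (integrable_finsetSum s fun j _ => hF.integrable _ _).aestronglyMeasurable)
      (ae_of_all _ htr)
  · calc ∫⁻ x, ‖trace e (T * F x)‖ₑ ∂μ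
        ≤ ∫⁻ x, ∑' j, ‖⟪CFC.sqrt T (e j), F x (CFC.sqrt T (e j))⟫_ℂ‖ₑ ∂μ :=
          lintegral_mono fun x => by
            rw [← (htr x).tsum_eq]
            exact enorm_tsum_le_tsum_enorm
      _ = ∑' j, ∫⁻ x, ‖⟪CFC.sqrt T (e j), F x (CFC.sqrt T (e j))⟫_ℂ‖ₑ ∂μ :=
          lintegral_tsum fun j => (hF.aestronglyMeasurable _ _).enorm
      _ < ⊤ := (hF.tsum_lintegral_enorm_inner_sqrt_ne_top hT hs).lt_top

theorem trace_mul_eq_integral_of_nonneg [Countable ι] (hF : WeaklyIntegrableWith C μ F)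
    (hA : ∀ v w, ⟪v, A w⟫_ℂ = ∫ x, ⟪v, F x w⟫_ℂ ∂μ) {T : H →L[ℂ] H}
    (hT : 0 ≤ T) (hs : Summable fun i => ⟪e i, T (e i)⟫_ℂ) :
    trace e (T * A) = ∫ x, trace e (T * F x) ∂μ := by
  simp only [← (hasSum_trace_mul_of_nonneg hT hs _).tsum_eq, hA]
  exact (integral_tsum (fun j => hF.aestronglyMeasurable _ _)
    (hF.tsum_lintegral_enorm_inner_sqrt_ne_top hT hs)).symm

end WeaklyIntegrableWith

variable [CompleteSpace H]

theorem HasGelfandIntegral.unique (hA : HasGelfandIntegral e μ F A)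
    (hB : HasGelfandIntegral e μ F B) : A = B :=
  eq_of_trace_state_mul_eq fun s => by
    rw [hA.trace_eq _ s.mem_traceClass, hB.trace_eq _ s.mem_traceClass]

theorem HasGelfandIntegral.add (hA : HasGelfandIntegral e μ F A)
    (hB : HasGelfandIntegral e μ G B) : HasGelfandIntegral e μ (fun x => F x + G x) (A + B) where
  integrable T hT := by
    simp only [trace_mul_add hT]
    exact (hA.integrable T hT).add (hB.integrable T hT)
  trace_eq T hT := by
    simp only [trace_mul_add hT]
    rw [integral_add (hA.integrable T hT) (hB.integrable T hT), hA.trace_eq T hT, hB.trace_eq T hT]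

theorem WeaklyIntegrableWith.hasGelfandIntegral [Countable ι] (hF : WeaklyIntegrableWith C μ F)
    (hA : ∀ v w, ⟪v, A w⟫_ℂ = ∫ x, ⟪v, F x w⟫_ℂ ∂μ) : HasGelfandIntegral e μ F A := by
  suffices h : ∀ T ∈ traceClass e, Integrable (fun x => trace e (T * F x)) μ ∧
      trace e (T * A) = ∫ x, trace e (T * F x) ∂μ from
    ⟨fun T hT => (h T hT).1, fun T hT => (h T hT).2⟩
  intro T hT
  induction hT using Submodule.span_induction with
  | mem T hT => exact ⟨hF.integrable_trace_mul_of_nonneg hT.1 hT.2,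
      hF.trace_mul_eq_integral_of_nonneg hA hT.1 hT.2⟩
  | zero => simp [trace]
  | add S T hS hT hFS hFT =>
    simp only [trace_add_mul hS hT]
    exact ⟨hFS.1.add hFT.1, by rw [integral_add hFS.1 hFT.1, hFS.2, hFT.2]⟩
  | smul c T _ hFT =>
    simp only [trace_smul_mul]
    exact ⟨hFT.1.const_mul c, by rw [integral_const_mul, hFT.2]⟩

theorem WeaklyIntegrableWith.exists_hasGelfandIntegral [Countable ι]
    (hF : WeaklyIntegrableWith C μ F) : ∃ A, HasGelfandIntegral e μ F A :=
  hF.exists_inner_eq_integral.imp fun _ hA => hF.hasGelfandIntegral hA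

theorem WeaklyIntegrableWith.hasGelfandIntegral_of_inner_basis [Countable ι]
    (hF : WeaklyIntegrableWith C μ F)
    (hA : ∀ i j, ⟪e i, A (e j)⟫_ℂ = ∫ x, ⟪e i, F x (e j)⟫_ℂ ∂μ) : HasGelfandIntegral e μ F A := by
  obtain ⟨B, hB⟩ := hF.exists_inner_eq_integral
  rw [eq_of_inner_apply_basis_eq e fun i j => (hA i j).trans (hB _ _).symm]
  exact hF.hasGelfandIntegral hB

theorem convex_unitIntervalIntegrals : Convex ℝ (unitIntervalIntegrals e μ F) := by
  rintro A ⟨h, hm, h01, hA⟩ B ⟨g, gm, g01, hB⟩ a b ha hb hab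
  have hsmul : ∀ (c : ℝ) (A : H →L[ℂ] H), c • A = (c : ℂ) • A := fun c A =>
    RCLike.real_smul_eq_coe_smul (K := ℂ) c A
  rw [hsmul, hsmul]
  refine ⟨fun x => a * h x + b * g x, (hm.const_mul a).add (gm.const_mul b),
    fun x => convex_Icc (0 : ℝ) 1 (h01 x) (g01 x) ha hb hab, ?_⟩
  convert (hA.const_smul a).add (hB.const_smul b) using 2
  push_cast
  module

theorem WeaklyIntegrableWith.exists_hasGelfandIntegral_smul [Countable ι]
    (hF : WeaklyIntegrableWith C μ F) {h : X → ℝ} (hm : Measurable h)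
    (h01 : ∀ x, h x ∈ Set.Icc (0 : ℝ) 1) :
    ∃ A, HasGelfandIntegral e μ (fun x => (h x : ℂ) • F x) A :=
  (hF.smul (M := 1) (Complex.measurable_ofReal.comp hm).aestronglyMeasurable <|
    ae_of_all _ fun x => by
      rw [Function.comp_apply, NNReal.coe_one, Complex.norm_real,
        Real.norm_of_nonneg (h01 x).1]
      exact (h01 x).2).exists_hasGelfandIntegral

theorem WeaklyIntegrableWith.isCompact_unitIntervalIntegrals [Countable ι] [IsFiniteMeasure μ]
    (hF : WeaklyIntegrableWith C μ F) :
    @IsCompact _ (ultraweak e) (unitIntervalIntegrals e μ F) := by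
  obtain ⟨A₁, hA₁⟩ := hF.exists_hasGelfandIntegral (e := e)
  rw [@Topology.IsInducing.isCompact_iff _ _ (ultraweak e) _ _ _ (isInducing_ultraweak e)]
  convert isCompact_moments (μ := μ)
    (d := fun (T : traceClass e) x => trace e ((T : H →L[ℂ] H) * F x))
    (fun T => hA₁.integrable T T.2) using 1
  ext c
  constructor
  · rintro ⟨A, ⟨h, hm, h01, hA⟩, rfl⟩
    exact ⟨h, hm, h01, fun T => by simp only [hA.trace_eq T T.2, trace_mul_smul]⟩
  · rintro ⟨h, hm, h01, hc⟩
    obtain ⟨A, hA⟩ := hF.exists_hasGelfandIntegral_smul (e := e) hm h01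
    refine ⟨A, ⟨h, hm, h01, hA⟩, funext fun T => ?_⟩
    simp only [hA.trace_eq T T.2, trace_mul_smul, hc T]

end WeakIntegral

section RadonNikodym

variable {ι H X : Type*} [NormedAddCommGroup H] [InnerProductSpace ℂ H] [CompleteSpace H]
  [MeasurableSpace X] {e : HilbertBasis ι ℂ H} {ν : POVM X e} {ρ : State e} {D : X → H →L[ℂ] H}

instance POVM.isFiniteMeasure_scalar (ν : POVM X e) (ρ : State e) :
    IsFiniteMeasure (ν.scalar ρ) :=
  ⟨by rw [POVM.scalar, Measure.ofMeasurable_apply _ MeasurableSet.univ]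
      exact ENNReal.ofReal_lt_top⟩

theorem posIntegrable_zero : PosIntegrable ν ρ D fun _ => 0 := fun s => by
  have hzero : sandwich D s (fun _ => 0) = 0 := by
    funext x
    simp [sandwich, trace]
  rw [hzero]
  exact integrable_zero _ _ _

theorem PosIntegrable.qIntegrable {f : X → H →L[ℂ] H} (hf : PosIntegrable ν ρ D f)
    (hpos : ∀ x, 0 ≤ f x) : QIntegrable ν ρ D f := by
  have hre : ∀ x, (ℜ (f x) : H →L[ℂ] H) = f x := fun x => (hpos x).isSelfAdjoint.coe_realPart
  have him : ∀ x, (ℑ (f x) : H →L[ℂ] H) = 0 := fun x => by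
    rw [(hpos x).isSelfAdjoint.imaginaryPart, ZeroMemClass.coe_zero]
  simp only [QIntegrable, hre, him, (CFC.posPart_eq_self _).2 (hpos _),
    (CFC.negPart_eq_zero_iff _ (hpos _).isSelfAdjoint).2 (hpos _), CFC.posPart_zero,
    CFC.negPart_zero]
  exact ⟨hf, posIntegrable_zero, posIntegrable_zero, posIntegrable_zero⟩

namespace IsRNDeriv

theorem scalar_eq_zero_iff (hD : IsRNDeriv ν ρ D) {E : Set X} (hE : MeasurableSet E) :
    ν.scalar ρ E = 0 ↔ ν E = 0 := by
  refine ⟨fun h => eq_of_inner_apply_basis_eq e fun i j => ?_, fun h => ?_⟩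
  · rw [hD.setIntegral_eq i j E hE, Measure.restrict_eq_zero.2 h, integral_zero_measure,
      zero_apply, inner_zero_right]
  · rw [← measureReal_eq_zero_iff, ← Complex.ofReal_eq_zero, ν.scalar_apply ρ hE, h]
    simp [trace]

theorem memLp_top (hD : IsRNDeriv ν ρ D) {E : Set X} {f : X → ℂ} (hf : IsLInfty ν E f) :
    MemLp f ⊤ (ν.scalar ρ) := by
  obtain ⟨M, hM⟩ := hf.essBounded
  rw [← hD.scalar_eq_zero_iff (measurableSet_lt measurable_const hf.measurable.norm)] at hM
  exact memLp_top_of_bound hf.measurable.aestronglyMeasurable M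
    (by simpa only [ae_iff, not_le] using hM)

theorem integrable_and_setIntegral_of_mem_span (hD : IsRNDeriv ν ρ D) {v w : H}
    (hv : v ∈ Submodule.span ℂ (Set.range e)) (hw : w ∈ Submodule.span ℂ (Set.range e)) :
    Integrable (fun x => ⟪v, D x w⟫_ℂ) (ν.scalar ρ) ∧
      ∀ E, MeasurableSet E → ⟪v, ν E w⟫_ℂ = ∫ x in E, ⟪v, D x w⟫_ℂ ∂(ν.scalar ρ) := by
  induction hv, hw using Submodule.span_induction₂ with
  | mem_mem v w hv hw =>
    obtain ⟨i, rfl⟩ := hv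
    obtain ⟨j, rfl⟩ := hw
    exact ⟨hD.integrable i j, hD.setIntegral_eq i j⟩
  | zero_left => simp
  | zero_right => simp
  | add_left v v' w _ _ _ h h' =>
    simp only [inner_add_left]
    exact ⟨h.1.add h'.1, fun E hE => by
      rw [integral_add h.1.integrableOn h'.1.integrableOn, h.2 E hE, h'.2 E hE]⟩
  | add_right v w w' _ _ _ h h' =>
    simp only [map_add, inner_add_right]
    exact ⟨h.1.add h'.1, fun E hE => by
      rw [integral_add h.1.integrableOn h'.1.integrableOn, h.2 E hE, h'.2 E hE]⟩
  | smul_left c v w _ _ h =>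
    simp only [inner_smul_left]
    exact ⟨h.1.const_mul _, fun E hE => by rw [integral_const_mul, h.2 E hE]⟩
  | smul_right c v w _ _ h =>
    simp only [map_smul, inner_smul_right]
    exact ⟨h.1.const_mul _, fun E hE => by rw [integral_const_mul, h.2 E hE]⟩

theorem ae_inner_apply_self_nonneg_of_mem_span (hD : IsRNDeriv ν ρ D) {v : H}
    (hv : v ∈ Submodule.span ℂ (Set.range e)) : ∀ᵐ x ∂(ν.scalar ρ), 0 ≤ ⟪v, D x v⟫_ℂ := by
  obtain ⟨hint, hE⟩ := hD.integrable_and_setIntegral_of_mem_span hv hv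
  have hnonneg : ∀ E, MeasurableSet E → 0 ≤ ∫ x in E, ⟪v, D x v⟫_ℂ ∂(ν.scalar ρ) := fun E hm =>
    (inner_apply_self_nonneg (ν.nonneg E hm) v).trans_eq (hE E hm)
  have hre : 0 ≤ᵐ[ν.scalar ρ] fun x => (⟪v, D x v⟫_ℂ).re :=
    ae_nonneg_of_forall_setIntegral_nonneg hint.re fun E hm _ =>
      (Complex.nonneg_iff.1 (hnonneg E hm)).1.trans_eq (integral_re hint.integrableOn).symm
  have him : (fun x => (⟪v, D x v⟫_ℂ).im) =ᵐ[ν.scalar ρ] 0 :=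
    hint.im.ae_eq_zero_of_forall_setIntegral_eq_zero fun E hm _ =>
      (integral_im hint.integrableOn).trans (Complex.nonneg_iff.1 (hnonneg E hm)).2.symm
  filter_upwards [hre, him] with x hxre hxim using Complex.nonneg_iff.2 ⟨hxre, hxim.symm⟩

theorem ae_nonneg [TopologicalSpace.SeparableSpace H] (hD : IsRNDeriv ν ρ D) :
    ∀ᵐ x ∂(ν.scalar ρ), 0 ≤ D x := by
  obtain ⟨c, hcspan, hccount, hcdense⟩ := (TopologicalSpace.IsSeparable.of_separableSpace
    (Submodule.span ℂ (Set.range e) : Set H)).exists_countable_dense_subset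
  have hdense : Dense c := dense_closure.1 ((dense_span_range e).mono hcdense)
  have hae : ∀ᵐ x ∂(ν.scalar ρ), ∀ v ∈ c, 0 ≤ ⟪v, D x v⟫_ℂ :=
    (ae_ball_iff hccount).2 fun v hv => hD.ae_inner_apply_self_nonneg_of_mem_span (hcspan hv)
  filter_upwards [hae] with x hx
  have hclosed : IsClosed {v : H | 0 ≤ ⟪v, D x v⟫_ℂ} :=
    isClosed_le continuous_const (continuous_id.inner (D x).continuous)
  exact nonneg_of_forall_inner_apply_self_nonneg fun v => hclosed.closure_subset_iff.2 hx (hdense v)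

theorem aestronglyMeasurable_inner_apply (hD : IsRNDeriv ν ρ D) (v w : H) :
    AEStronglyMeasurable (fun x => ⟪v, D x w⟫_ℂ) (ν.scalar ρ) := by
  obtain ⟨a, ha, hav⟩ := mem_closure_iff_seq_limit.1 (dense_span_range e v)
  obtain ⟨b, hb, hbw⟩ := mem_closure_iff_seq_limit.1 (dense_span_range e w)
  exact aestronglyMeasurable_of_tendsto_ae atTop
    (fun n => (hD.integrable_and_setIntegral_of_mem_span (ha n) (hb n)).1.aestronglyMeasurable)
    (ae_of_all _ fun x => hav.inner (((D x).continuous.tendsto w).comp hbw))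

theorem lintegral_enorm_inner_apply_self_of_mem_span (hD : IsRNDeriv ν ρ D) {v : H}
    (hv : v ∈ Submodule.span ℂ (Set.range e)) :
    ∫⁻ x, ‖⟪v, D x v⟫_ℂ‖ₑ ∂(ν.scalar ρ) = ‖⟪v, ν Set.univ v⟫_ℂ‖ₑ := by
  obtain ⟨hint, hE⟩ := hD.integrable_and_setIntegral_of_mem_span hv hv
  have hnorm : ((∫ x, ‖⟪v, D x v⟫_ℂ‖ ∂(ν.scalar ρ) : ℝ) : ℂ) = ⟪v, ν Set.univ v⟫_ℂ := by
    rw [hE _ MeasurableSet.univ, Measure.restrict_univ, ← integral_complex_ofReal]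
    refine integral_congr_ae ?_
    filter_upwards [hD.ae_inner_apply_self_nonneg_of_mem_span hv] with x hx
    exact Complex.norm_of_nonneg' hx
  rw [← ofReal_integral_norm_eq_lintegral_enorm hint, ← hnorm, ← ofReal_norm, Complex.norm_real,
    Real.norm_of_nonneg (integral_nonneg fun _ => norm_nonneg _)]

theorem lintegral_enorm_inner_apply_self_le (hD : IsRNDeriv ν ρ D) (v : H) :
    ∫⁻ x, ‖⟪v, D x v⟫_ℂ‖ₑ ∂(ν.scalar ρ) ≤ ‖⟪v, ν Set.univ v⟫_ℂ‖ₑ := by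
  obtain ⟨a, ha, hav⟩ := mem_closure_iff_seq_limit.1 (dense_span_range e v)
  have hlim : ∀ A : H →L[ℂ] H, Tendsto (fun n => ‖⟪a n, A (a n)⟫_ℂ‖ₑ) atTop (𝓝 ‖⟪v, A v⟫_ℂ‖ₑ) :=
    fun A => (hav.inner ((A.continuous.tendsto v).comp hav)).enorm
  calc ∫⁻ x, ‖⟪v, D x v⟫_ℂ‖ₑ ∂(ν.scalar ρ)
      = ∫⁻ x, liminf (fun n => ‖⟪a n, D x (a n)⟫_ℂ‖ₑ) atTop ∂(ν.scalar ρ) :=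
        lintegral_congr fun x => (hlim (D x)).liminf_eq.symm
    _ ≤ liminf (fun n => ∫⁻ x, ‖⟪a n, D x (a n)⟫_ℂ‖ₑ ∂(ν.scalar ρ)) atTop :=
        lintegral_liminf_le' fun n => (hD.aestronglyMeasurable_inner_apply _ _).enorm
    _ = ‖⟪v, ν Set.univ v⟫_ℂ‖ₑ := by
        simp only [hD.lintegral_enorm_inner_apply_self_of_mem_span (ha _)]
        exact (hlim (ν Set.univ)).liminf_eq

variable [TopologicalSpace.SeparableSpace H]

theorem weaklyIntegrableWith (hD : IsRNDeriv ν ρ D) :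
    WeaklyIntegrableWith ‖ν Set.univ‖₊ (ν.scalar ρ) D where
  aestronglyMeasurable := hD.aestronglyMeasurable_inner_apply
  lintegral_enorm_le v w := by
    have hdiag : ∀ u, ∫⁻ x, ‖⟪u, D x u⟫_ℂ‖ₑ ∂(ν.scalar ρ) ≤ ‖ν Set.univ‖ₑ * ‖u‖ₑ ^ 2 := fun u => by
      calc ∫⁻ x, ‖⟪u, D x u⟫_ℂ‖ₑ ∂(ν.scalar ρ)
          ≤ ‖⟪u, ν Set.univ u⟫_ℂ‖ₑ := hD.lintegral_enorm_inner_apply_self_le u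
        _ ≤ ‖u‖ₑ * ‖ν Set.univ u‖ₑ := ENNReal.coe_le_coe.2 (nnnorm_inner_le_nnnorm (𝕜 := ℂ) _ _)
        _ ≤ ‖u‖ₑ * (‖ν Set.univ‖ₑ * ‖u‖ₑ) := by
            gcongr
            exact (ν Set.univ).le_opENorm u
        _ = ‖ν Set.univ‖ₑ * ‖u‖ₑ ^ 2 := by ring
    calc ∫⁻ x, ‖⟪v, D x w⟫_ℂ‖ₑ ∂(ν.scalar ρ)
        ≤ ∫⁻ x, ‖⟪v, D x v⟫_ℂ‖ₑ ^ (1 / 2 : ℝ) * ‖⟪w, D x w⟫_ℂ‖ₑ ^ (1 / 2 : ℝ) ∂(ν.scalar ρ) :=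
          lintegral_mono_ae <| hD.ae_nonneg.mono fun x hx => enorm_inner_apply_le hx v w
      _ ≤ (∫⁻ x, ‖⟪v, D x v⟫_ℂ‖ₑ ∂(ν.scalar ρ)) ^ (1 / 2 : ℝ)
          * (∫⁻ x, ‖⟪w, D x w⟫_ℂ‖ₑ ∂(ν.scalar ρ)) ^ (1 / 2 : ℝ) :=
          ENNReal.lintegral_mul_norm_pow_le (hD.aestronglyMeasurable_inner_apply v v).enorm
            (hD.aestronglyMeasurable_inner_apply w w).enorm (by norm_num) (by norm_num)
            (by norm_num)
      _ ≤ (‖ν Set.univ‖ₑ * ‖v‖ₑ ^ 2) ^ (1 / 2 : ℝ) * (‖ν Set.univ‖ₑ * ‖w‖ₑ ^ 2) ^ (1 / 2 : ℝ) := by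
          gcongr <;> exact hdiag _
      _ = ((‖ν Set.univ‖ₑ * ‖v‖ₑ * ‖w‖ₑ) ^ 2) ^ (1 / 2 : ℝ) := by
          rw [← ENNReal.mul_rpow_of_nonneg _ _ (by norm_num)]
          ring_nf
      _ = ‖ν Set.univ‖₊ * ‖v‖ₑ * ‖w‖ₑ := by
          rw [← ENNReal.rpow_natCast_mul]
          norm_num [enorm_eq_nnnorm]

theorem hasGelfandIntegral_indicator (hD : IsRNDeriv ν ρ D) {E : Set X} (hE : MeasurableSet E) :
    HasGelfandIntegral e (ν.scalar ρ) (fun x => ((E.indicator 1 x : ℝ) : ℂ) • D x) (ν E) := by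
  have := countable_of_hilbertBasis e
  have hm : Measurable (E.indicator (1 : X → ℝ)) := measurable_one.indicator hE
  refine (hD.weaklyIntegrableWith.smul (M := 1)
    (Complex.measurable_ofReal.comp hm).aestronglyMeasurable
    (ae_of_all _ fun x => ?_)).hasGelfandIntegral_of_inner_basis fun i j => ?_
  · by_cases hx : x ∈ E <;> simp [hx]
  · rw [hD.setIntegral_eq i j E hE, ← integral_indicator hE]
    refine integral_congr_ae (ae_of_all _ fun x => ?_)
    by_cases hx : x ∈ E <;> simp [hx]

theorem exists_hasGelfandIntegral_smul (hD : IsRNDeriv ν ρ D) {h : X → ℝ} (hm : Measurable h)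
    (h01 : ∀ x, h x ∈ Set.Icc (0 : ℝ) 1) :
    ∃ A, HasGelfandIntegral e (ν.scalar ρ) (fun x => (h x : ℂ) • D x) A :=
  have := countable_of_hilbertBasis e
  hD.weaklyIntegrableWith.exists_hasGelfandIntegral_smul hm h01

theorem isCompact_unitIntervalIntegrals (hD : IsRNDeriv ν ρ D) :
    @IsCompact _ (ultraweak e) (unitIntervalIntegrals e (ν.scalar ρ) D) :=
  have := countable_of_hilbertBasis e
  hD.weaklyIntegrableWith.isCompact_unitIntervalIntegrals

theorem integrable_trace_mul (hD : IsRNDeriv ν ρ D) (s : State e) :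
    Integrable (fun x => trace e (s.op * D x)) (ν.scalar ρ) :=
  have := countable_of_hilbertBasis e
  hD.weaklyIntegrableWith.integrable_trace_mul_of_nonneg s.nonneg s.hasSum_one.summable

theorem sandwich_smul_one_ae_eq (hD : IsRNDeriv ν ρ D) (s : State e) (f : X → ℂ) :
    sandwich D s (fun x => f x • 1) =ᵐ[ν.scalar ρ] fun x => trace e (s.op * (f x • D x)) :=
  hD.ae_nonneg.mono fun x hx => by
    rw [sandwich, mul_smul_comm, mul_one, smul_mul_assoc, CFC.sqrt_mul_sqrt_self _ hx]

theorem hasQIntegral_smul_one_iff (hD : IsRNDeriv ν ρ D) {h : X → ℝ} (hm : Measurable h)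
    (h01 : ∀ x, h x ∈ Set.Icc (0 : ℝ) 1) {A : H →L[ℂ] H} :
    HasQIntegral ν ρ D (fun x => (h x : ℂ) • 1) A ↔
      HasGelfandIntegral e (ν.scalar ρ) (fun x => (h x : ℂ) • D x) A := by
  have hsandwich := fun s => hD.sandwich_smul_one_ae_eq s fun x => (h x : ℂ)
  constructor
  · intro hA
    obtain ⟨B, hB⟩ := hD.exists_hasGelfandIntegral_smul hm h01
    have hAB : A = B := eq_of_trace_state_mul_eq fun s => by
      rw [hA.trace_eq, hB.trace_eq _ s.mem_traceClass, integral_congr_ae (hsandwich s)]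
    rwa [hAB]
  · intro hA
    have hint : PosIntegrable ν ρ D fun x => (h x : ℂ) • (1 : H →L[ℂ] H) := fun s =>
      (hA.integrable _ s.mem_traceClass).congr (hsandwich s).symm
    refine ⟨fun s => ?_, hint.qIntegrable fun x => ?_, fun s => ?_⟩
    · simp only [trace_mul_smul, mul_one]
      exact (Complex.measurable_ofReal.comp hm).mul_const _
    · exact smul_nonneg (Complex.zero_le_real.2 (h01 x).1) zero_le_one
    · rw [hA.trace_eq _ s.mem_traceClass, integral_congr_ae (hsandwich s)]

theorem existsUnique_hasQIntegral_smul_one (hD : IsRNDeriv ν ρ D) {h : X → ℝ} (hm : Measurable h)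
    (h01 : ∀ x, h x ∈ Set.Icc (0 : ℝ) 1) :
    ∃! A, HasQIntegral ν ρ D (fun x => (h x : ℂ) • 1) A := by
  simp only [hD.hasQIntegral_smul_one_iff hm h01]
  obtain ⟨A, hA⟩ := hD.exists_hasGelfandIntegral_smul hm h01
  exact ⟨A, hA, fun B hB => hB.unique hA⟩

theorem unitIntervalIntegrals_eq (hD : IsRNDeriv ν ρ D) :
    unitIntervalIntegrals e (ν.scalar ρ) D =
      {A | ∃ h : X → ℝ, Measurable h ∧ (∀ x, h x ∈ Set.Icc (0 : ℝ) 1) ∧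
        HasQIntegral ν ρ D (fun x => (h x : ℂ) • 1) A} :=
  Set.ext fun _ => exists_congr fun _ => and_congr_right fun hm => and_congr_right fun h01 =>
    (hD.hasQIntegral_smul_one_iff hm h01).symm

theorem ae_ofReal_re_trace_mul (hD : IsRNDeriv ν ρ D) (s : State e) :
    ∀ᵐ x ∂(ν.scalar ρ), ((trace e (s.op * D x)).re : ℂ) = trace e (s.op * D x) := by
  filter_upwards [hD.ae_nonneg] with x hx
  have htrace := trace_nonneg e s.nonneg s.hasSum_one.summable hx
  exact Complex.ext rfl (Complex.nonneg_iff.1 htrace).2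

theorem trace_mul_eq_ofReal_integral (hD : IsRNDeriv ν ρ D) {h : X → ℝ} {A : H →L[ℂ] H}
    (hA : HasGelfandIntegral e (ν.scalar ρ) (fun x => (h x : ℂ) • D x) A) (s : State e) :
    trace e (s.op * A) = ((∫ x, h x * (trace e (s.op * D x)).re ∂(ν.scalar ρ) : ℝ) : ℂ) := by
  rw [hA.trace_eq _ s.mem_traceClass, ← integral_complex_ofReal]
  refine integral_congr_ae ?_
  filter_upwards [hD.ae_ofReal_re_trace_mul s] with x hx
  rw [trace_mul_smul, Complex.ofReal_mul, hx]

theorem integral_mul_re_trace (hD : IsRNDeriv ν ρ D) {f : X → ℂ} {A : H →L[ℂ] H}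
    (hA : HasQIntegral ν ρ D (fun x => f x • 1) A) (s : State e) :
    ∫ x, f x * ((trace e (s.op * D x)).re : ℂ) ∂(ν.scalar ρ) = trace e (s.op * A) := by
  rw [hA.trace_eq]
  refine integral_congr_ae ?_
  filter_upwards [hD.ae_ofReal_re_trace_mul s, hD.sandwich_smul_one_ae_eq s f] with x hre hx
  rw [hre, hx, trace_mul_smul]

theorem nowhereInjectiveMoments (hD : IsRNDeriv ν ρ D) (hinj : ClassicallyNonInjective ν ρ D) :
    NowhereInjectiveMoments (ν.scalar ρ)
      fun (s : State e) x => (trace e (s.op * D x)).re := by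
  intro E hE hE0
  obtain ⟨f, g, hf, hg, hfg, A, hfA, hgA⟩ := hinj E hE ((hD.scalar_eq_zero_iff hE).not.1 hE0)
  have hfLp := hD.memLp_top hf
  have hgLp := hD.memLp_top hg
  have hne : MeasurableSet {x | f x ≠ g x} :=
    (measurableSet_eq_fun hf.measurable hg.measurable).compl
  rw [Ne, ← hD.scalar_eq_zero_iff hne] at hfg
  refine exists_Lp_ne_zero_of_memLp (d := fun (s : State e) x => (trace e (s.op * D x)).re)
    (fun s => (hD.integrable_trace_mul s).re) (hfLp.sub hgLp) (fun x hx => ?_)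
    (fun h0 => hfg ?_) fun s => ?_
  · rw [Pi.sub_apply, hf.eq_zero x hx, hg.eq_zero x hx, sub_zero]
  · exact h0.mono fun x hx => sub_eq_zero.1 hx
  · have hint : ∀ {k : X → ℂ}, MemLp k ⊤ (ν.scalar ρ) →
        Integrable (fun x => k x * ((trace e (s.op * D x)).re : ℂ)) (ν.scalar ρ) := fun hk =>
      (hD.integrable_trace_mul s).re.ofReal.mul_of_top_right hk
    simp only [Pi.sub_apply, sub_mul]
    rw [integral_sub (hint hfLp) (hint hgLp), hD.integral_mul_re_trace hfA,
      hD.integral_mul_re_trace hgA, sub_self]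

theorem range_eq_unitIntervalIntegrals (hD : IsRNDeriv ν ρ D)
    (hinj : ClassicallyNonInjective ν ρ D) :
    {A | ∃ E, MeasurableSet E ∧ ν E = A} = unitIntervalIntegrals e (ν.scalar ρ) D := by
  refine Set.Subset.antisymm ?_ ?_
  · rintro _ ⟨E, hE, rfl⟩
    refine ⟨E.indicator 1, measurable_one.indicator hE, fun x => ?_,
      hD.hasGelfandIntegral_indicator hE⟩
    by_cases hx : x ∈ E <;> simp [hx]
  · rintro A ⟨h, hm, h01, hA⟩
    have hhLp : MemLp h ⊤ (ν.scalar ρ) := memLp_top_of_mem_Icc hm h01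
    obtain ⟨E, hE, hEs⟩ := exists_setIntegral_eq
      (c := fun s => ∫ x, h x * (trace e (s.op * D x)).re ∂(ν.scalar ρ))
      (hD.nowhereInjectiveMoments hinj) (fun s => (hD.integrable_trace_mul s).re)
      ⟨hhLp.toLp h, hhLp.coeFn_toLp.mono fun x hx => hx ▸ h01 x,
        fun s => integral_congr_ae (hhLp.coeFn_toLp.mono fun x hx => by simp only [hx])⟩
    refine ⟨E, hE, eq_of_trace_state_mul_eq (e := e) fun s => ?_⟩
    rw [hD.trace_mul_eq_ofReal_integral hA, ← hEs,
      hD.trace_mul_eq_ofReal_integral (hD.hasGelfandIntegral_indicator hE), ← integral_indicator hE]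
    congr 2
    funext x
    by_cases hx : x ∈ E <;> simp [hx]

end IsRNDeriv

end RadonNikodym

end OperatorMeasure

theorem theorem3p1_general {ι H X : Type*} [NormedAddCommGroup H] [InnerProductSpace ℂ H]
    [CompleteSpace H] [TopologicalSpace.SeparableSpace H] [MeasurableSpace X]
    (e : HilbertBasis ι ℂ H) (ν : OperatorMeasure.POVM X e) (ρ : OperatorMeasure.State e)
    (D : X → (H →L[ℂ] H)) (hD : OperatorMeasure.IsRNDeriv ν ρ D)
    (hinj : OperatorMeasure.ClassicallyNonInjective ν ρ D) :
    Convex ℝ {A : H →L[ℂ] H | ∃ E, MeasurableSet E ∧ ν E = A} ∧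
    @IsCompact _ (OperatorMeasure.ultraweak e) {A : H →L[ℂ] H | ∃ E, MeasurableSet E ∧ ν E = A} ∧
    (∀ h : X → ℝ, Measurable h → (∀ x, h x ∈ Set.Icc (0 : ℝ) 1) →
      ∃! A : H →L[ℂ] H, OperatorMeasure.HasQIntegral ν ρ D (fun x => (h x : ℂ) • 1) A) ∧
    {A : H →L[ℂ] H | ∃ E, MeasurableSet E ∧ ν E = A} =
      {A : H →L[ℂ] H | ∃ h : X → ℝ, Measurable h ∧ (∀ x, h x ∈ Set.Icc (0 : ℝ) 1) ∧
        OperatorMeasure.HasQIntegral ν ρ D (fun x => (h x : ℂ) • 1) A} := by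
  have hrange := hD.range_eq_unitIntervalIntegrals hinj
  exact ⟨hrange ▸ OperatorMeasure.convex_unitIntervalIntegrals,
    hrange ▸ hD.isCompact_unitIntervalIntegrals,
    fun _ hm h01 => hD.existsUnique_hasQIntegral_smul_one hm h01,
    hrange.trans hD.unitIntervalIntegrals_eq⟩

theorem theorem3p1 {ι H X : Type*} [NormedAddCommGroup H] [InnerProductSpace ℂ H]
    [CompleteSpace H] [TopologicalSpace.SeparableSpace H] [MeasurableSpace X]
    (e : HilbertBasis ι ℂ H) (ν : OperatorMeasure.POVM X e) (hν : ν.Nonatomic)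
    (ρ : OperatorMeasure.State e) (hρ : ρ.FullRank)
    (D : X → (H →L[ℂ] H)) (hD : OperatorMeasure.IsRNDeriv ν ρ D)
    (hinj : OperatorMeasure.ClassicallyNonInjective ν ρ D) :
    Convex ℝ {A : H →L[ℂ] H | ∃ E, MeasurableSet E ∧ ν E = A} ∧
    @IsCompact _ (OperatorMeasure.ultraweak e) {A : H →L[ℂ] H | ∃ E, MeasurableSet E ∧ ν E = A} ∧
    (∀ h : X → ℝ, Measurable h → (∀ x, h x ∈ Set.Icc (0 : ℝ) 1) →
      ∃! A : H →L[ℂ] H, OperatorMeasure.HasQIntegral ν ρ D (fun x => (h x : ℂ) • 1) A) ∧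
    {A : H →L[ℂ] H | ∃ E, MeasurableSet E ∧ ν E = A} =
      {A : H →L[ℂ] H | ∃ h : X → ℝ, Measurable h ∧ (∀ x, h x ∈ Set.Icc (0 : ℝ) 1) ∧
        OperatorMeasure.HasQIntegral ν ρ D (fun x => (h x : ℂ) • 1) A} :=
  theorem3p1_general e ν ρ D hD hinj
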